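/- Conventions. A partially ordered abelian group $G$ is a *dimension group* if it is directed, unperforated ($ng\ge 0$ with $n\ge 1$ implies $g\ge 0$) and has the Riesz interpolation property. It is *simple* if it is nonzero and its only order ideals (convex directed subgroups) are $\{0\}$ and $G$. An *order unit* is an $e\ge 0$ such that every $g\in G$ satisfies $g\le ne$ for some $n\in\mathbf N$. The *trace space* $S(G,e)$ is the convex set of positive group homomorphisms $\tau:G\to\mathbf R$ with $\tau(e)=1$, with the topology of pointwise convergence; its extreme points are the *pure traces*. The order unit induces the pseudo-norm $\|g\|_e=\sup_{\tau\in S(G,e)}|\tau(g)|$, and *continuous* homomorphisms are those continuous for these pseudo-norms. $(G,e)$ is *approximately divisible* if $\tau(G)$ is dense in $\mathbf R$ for every pure trace $\tau$. Let $\mathcal H$ be the class of *pro-finite dimensional* dimension groups, i.e. those that are direct limits, over a directed set, of approximately divisible dimension groups $(G_\alpha,u_\alpha)$ with order unit, each having only finitely many pure traces, with positive transition homomorphisms that send each $u_\alpha$ to an order unit. A dimension group $R$ with order unit is *strongly anti-finite dimensional* (Anti-FD) if every continuous group homomorphism $\phi:H\to R$ with $H\in\mathcal H$ is zero. A *Choquet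 simplex* is a compact convex subset $K$ of a Hausdorff locally convex real topological vector space such that the cone $\{(tx,t): t\ge 0,\ x\in K\}$ is a lattice in the order it defines; $\operatorname{Aff}K$ is the Banach space of continuous affine functions $K\to\mathbf R$ with the supremum norm. The *strict ordering* on a subgroup of $\operatorname{Aff}K$ is the one in which $f\le g$ iff $f=g$ or $f(x)<g(x)$ for all $x\in K$. **Proposition 3.3.** Let $K$ be an infinite-dimensional (not necessarily metrizable) Choquet simplex. Then there exists a dense subgroup $G$ of $\operatorname{Aff}K$, containing the constant function $\mathbf 1$, such that * $G$ is free as an abelian group, and every finitely generated subgroup of $G$ is discrete in the norm topology; * with the strict ordering, $G$ is a simple dimension group with order unit $\mathbf 1$; * its trace space is $K$: the map $x\mapsto (g\mapsto g(x))$ is an affine homeomorphism from $K$ onto $S(G,\mathbf 1)$; * $G$ is strongly anti-finite dimensional (Anti-FD). -/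

import Mathlib

universe u v

/-! ### Partially ordered abelian groups and their traces -/

section OrderedGroups

/-- An order unit of a partially ordered abelian group. -/
def IsOrderUnit {G : Type u} [AddCommGroup G] [PartialOrder G] (e : G) : Prop :=
  0 ≤ e ∧ ∀ g : G, ∃ n : ℕ, g ≤ n • e

/-- A dimension group: a directed, unperforated partially ordered abelian group with the Riesz
interpolation property. -/
structure IsDimensionGroup (G : Type u) [AddCommGroup G] [PartialOrder G] : Prop where
  isOrderedAddMonoid : IsOrderedAddMonoid G
  directed : ∀ x y : G, ∃ z : G, x ≤ z ∧ y ≤ z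
  unperforated : ∀ (n : ℕ) (g : G), 0 < n → 0 ≤ n • g → 0 ≤ g
  interpolation : ∀ x₁ x₂ y₁ y₂ : G, x₁ ≤ y₁ → x₁ ≤ y₂ → x₂ ≤ y₁ → x₂ ≤ y₂ →
    ∃ z : G, x₁ ≤ z ∧ x₂ ≤ z ∧ z ≤ y₁ ∧ z ≤ y₂

/-- An order ideal: a convex subgroup that is directed (every element is a difference of positive
elements of the subgroup). -/
def IsOrderIdeal {G : Type u} [AddCommGroup G] [PartialOrder G] (I : AddSubgroup G) : Prop :=
  (∀ x ∈ I, ∀ y ∈ I, ∀ z : G, x ≤ z → z ≤ y → z ∈ I) ∧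
    (∀ x ∈ I, ∃ a ∈ I, ∃ b ∈ I, 0 ≤ a ∧ 0 ≤ b ∧ x = a - b)

/-- A partially ordered abelian group is simple if it is nonzero and has no order ideals other than
zero and the whole group. -/
def IsSimpleOrderedGroup (G : Type u) [AddCommGroup G] [PartialOrder G] : Prop :=
  Nontrivial G ∧ ∀ I : AddSubgroup G, IsOrderIdeal I → I = ⊥ ∨ I = ⊤

/-- The trace space `S(G, e)`: the positive group homomorphisms `τ : G → ℝ` with `τ e = 1`. It is a
convex subset of `G → ℝ` and carries the topology of pointwise convergence. -/
def traceSpace {G : Type u} [AddCommGroup G] [PartialOrder G] (e : G) : Set (G → ℝ) :=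
  {τ | (∀ x y : G, τ (x + y) = τ x + τ y) ∧ (∀ x : G, 0 ≤ x → 0 ≤ τ x) ∧ τ e = 1}

/-- The pure traces: the extreme points of the trace space. -/
def pureTraces {G : Type u} [AddCommGroup G] [PartialOrder G] (e : G) : Set (G → ℝ) :=
  Set.extremePoints ℝ (traceSpace e)

/-- Approximate divisibility: every pure trace has dense range in `ℝ`. -/
def IsApproximatelyDivisible {G : Type u} [AddCommGroup G] [PartialOrder G] (e : G) : Prop :=
  ∀ τ ∈ pureTraces e, Dense (Set.range τ)

/-- The pseudo-norm on `G` coming from the affine representation `g ↦ (τ ↦ τ g)` and the supremum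
norm of functions on `S(G, e)`. (For an order unit `e` the supremum is over a bounded family.) -/
noncomputable def pseudoNorm {G : Type u} [AddCommGroup G] [PartialOrder G] (e g : G) : ℝ :=
  ⨆ τ : traceSpace e, |(τ : G → ℝ) g|

/-- Continuity of a group homomorphism with respect to the pseudo-norms given by order units. -/
def IsPseudoNormContinuous {G : Type u} {H : Type v} [AddCommGroup G] [PartialOrder G]
    [AddCommGroup H] [PartialOrder H] (e : G) (w : H) (φ : G →+ H) : Prop :=
  ∀ g : G, ∀ ε : ℝ, 0 < ε → ∃ δ : ℝ, 0 < δ ∧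
    ∀ h : G, pseudoNorm e (h - g) < δ → pseudoNorm w (φ h - φ g) < ε

/-- A presentation of the partially ordered abelian group `H` as a direct limit, over a nonempty
directed set and with positive transition homomorphisms respecting order units, of approximately
divisible dimension groups with order unit that have only finitely many pure traces. -/
structure ProFDPresentation (H : Type u) [AddCommGroup H] [PartialOrder H] where
  ι : Type u
  [preorder : Preorder ι]
  [nonempty : Nonempty ι]
  directed : ∀ i j : ι, ∃ k : ι, i ≤ k ∧ j ≤ k
  obj : ι → Type u
  [group : ∀ i, AddCommGroup (obj i)]
  [order : ∀ i, PartialOrder (obj i)]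
  dimensionGroup : ∀ i, IsDimensionGroup (obj i)
  /-- the order units -/
  unit : ∀ i, obj i
  isOrderUnit : ∀ i, IsOrderUnit (unit i)
  approximatelyDivisible : ∀ i, IsApproximatelyDivisible (unit i)
  finite_pureTraces : ∀ i, (pureTraces (unit i)).Finite
  /-- the transition maps -/
  trans : ∀ i j, i ≤ j → (obj i →+ obj j)
  trans_nonneg : ∀ i j (h : i ≤ j) (g : obj i), 0 ≤ g → 0 ≤ trans i j h g
  trans_unit : ∀ i j (h : i ≤ j), IsOrderUnit (trans i j h (unit i))
  trans_refl : ∀ i (h : i ≤ i) (g : obj i), trans i i h g = g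
  trans_trans : ∀ i j k (hij : i ≤ j) (hjk : j ≤ k) (hik : i ≤ k) (g : obj i),
    trans j k hjk (trans i j hij g) = trans i k hik g
  /-- the maps to the limit -/
  toLim : ∀ i, obj i →+ H
  toLim_trans : ∀ i j (h : i ≤ j) (g : obj i), toLim j (trans i j h g) = toLim i g
  /- the following three fields say that `H`, as an ordered group, is the direct limit -/
  toLim_surjective : ∀ x : H, ∃ (i : ι) (g : obj i), toLim i g = x
  toLim_eq_zero : ∀ i (g : obj i), toLim i g = 0 → ∃ (j : ι) (h : i ≤ j), trans i j h g = 0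
  nonneg_iff : ∀ x : H, 0 ≤ x ↔ ∃ (i : ι) (g : obj i), 0 ≤ g ∧ toLim i g = x

/-- Pro-finite dimensional (pro-fd) dimension groups. -/
def IsProFD (H : Type u) [AddCommGroup H] [PartialOrder H] : Prop :=
  IsDimensionGroup H ∧ Nonempty (ProFDPresentation H)

/-- The dimension group `R` with order unit `w` is strongly anti-finite dimensional (Anti-FD): every
continuous group homomorphism from a pro-fd dimension group to `R` is zero. The universe `v` of the
pro-fd dimension groups is arbitrary. -/
def IsStronglyAntiFD {R : Type u} [AddCommGroup R] [PartialOrder R] (w : R) : Prop :=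
  IsDimensionGroup R ∧ IsOrderUnit w ∧
    ∀ (H : Type v) [AddCommGroup H] [PartialOrder H] (e : H), IsProFD H → IsOrderUnit e →
      ∀ φ : H →+ R, IsPseudoNormContinuous e w φ → φ = 0

end OrderedGroups

/-! ### Choquet simplices and their affine function spaces -/

section Simplices

/-- The cone `{(t x, t) : t ≥ 0, x ∈ K}` over `K × {1}`. -/
def coneOver {E : Type u} [AddCommGroup E] [Module ℝ E] (K : Set E) : Set (E × ℝ) :=
  {p | ∃ t : ℝ, 0 ≤ t ∧ ∃ x ∈ K, p = (t • x, t)}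

/-- A Choquet simplex: a compact convex set `K` such that the cone over `K × {1}` is a lattice in
the order it defines (`a ≤ b` iff `b - a` lies in the cone). -/
structure IsChoquetSimplex {E : Type u} [AddCommGroup E] [Module ℝ E] [TopologicalSpace E]
    (K : Set E) : Prop where
  convex : Convex ℝ K
  isCompact : IsCompact K
  exists_sup : ∀ a ∈ coneOver K, ∀ b ∈ coneOver K, ∃ c ∈ coneOver K,
    c - a ∈ coneOver K ∧ c - b ∈ coneOver K ∧
      ∀ d ∈ coneOver K, d - a ∈ coneOver K → d - b ∈ coneOver K → d - c ∈ coneOver K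
  exists_inf : ∀ a ∈ coneOver K, ∀ b ∈ coneOver K, ∃ c ∈ coneOver K,
    a - c ∈ coneOver K ∧ b - c ∈ coneOver K ∧
      ∀ d ∈ coneOver K, a - d ∈ coneOver K → b - d ∈ coneOver K → c - d ∈ coneOver K

/-- `Aff K`: the continuous affine functions `K → ℝ`. The topology is that of `C(K, ℝ)`, which is
the supremum norm topology when `K` is compact. -/
def Aff {E : Type u} [AddCommGroup E] [Module ℝ E] [TopologicalSpace E] (K : Set E) :
    Submodule ℝ C(K, ℝ) where
  carrier := {f | ∀ (x y z : K) (a b : ℝ), 0 ≤ a → 0 ≤ b → a + b = 1 →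
    (z : E) = a • (x : E) + b • (y : E) → f z = a * f x + b * f y}
  add_mem' := by
    intro f g hf hg x y z a b ha hb hab hz
    simp only [ContinuousMap.add_apply, hf x y z a b ha hb hab hz, hg x y z a b ha hb hab hz]
    ring
  zero_mem' := by
    intro x y z a b _ _ _ _
    simp
  smul_mem' := by
    intro c f hf x y z a b ha hb hab hz
    simp only [ContinuousMap.smul_apply, smul_eq_mul, hf x y z a b ha hb hab hz]
    ring

/-- The constant function `1` in `Aff K`. -/
def Aff.one {E : Type u} [AddCommGroup E] [Module ℝ E] [TopologicalSpace E] (K : Set E) : Aff K :=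
  ⟨1, by
    intro x y z a b _ _ hab _
    simp [hab]⟩

/-- A subgroup `G` of `Aff K`, to be equipped with the strict ordering (rather than the pointwise
ordering of functions). -/
def StrictlyOrdered {E : Type u} [AddCommGroup E] [Module ℝ E] [TopologicalSpace E] {K : Set E}
    (G : AddSubgroup (Aff K)) : Type u := G

instance {E : Type u} [AddCommGroup E] [Module ℝ E] [TopologicalSpace E] {K : Set E}
    (G : AddSubgroup (Aff K)) : AddCommGroup (StrictlyOrdered G) :=
  inferInstanceAs (AddCommGroup G)

/-- The constant function `1` as an element of a strictly ordered subgroup containing it. -/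
def StrictlyOrdered.one {E : Type u} [AddCommGroup E] [Module ℝ E] [TopologicalSpace E]
    {K : Set E} {G : AddSubgroup (Aff K)} (h : Aff.one K ∈ G) : StrictlyOrdered G :=
  ⟨Aff.one K, h⟩

/-- The value at the point `x` of an element of a subgroup of `Aff K`. -/
def StrictlyOrdered.eval {E : Type u} [AddCommGroup E] [Module ℝ E] [TopologicalSpace E]
    {K : Set E} {G : AddSubgroup (Aff K)} (g : StrictlyOrdered G) (x : K) : ℝ :=
  (g.1 : C(K, ℝ)) x

theorem StrictlyOrdered.ext {E : Type u} [AddCommGroup E] [Module ℝ E] [TopologicalSpace E]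
    {K : Set E} {G : AddSubgroup (Aff K)} {f g : StrictlyOrdered G}
    (h : ∀ x : K, f.eval x = g.eval x) : f = g :=
  Subtype.ext (Subtype.ext (ContinuousMap.ext h))

/-- The strict ordering: `f ≤ g` iff `f = g` or `f x < g x` for all `x ∈ K`. -/
instance {E : Type u} [AddCommGroup E] [Module ℝ E] [TopologicalSpace E] {K : Set E}
    (G : AddSubgroup (Aff K)) : PartialOrder (StrictlyOrdered G) where
  le f g := f = g ∨ ∀ x : K, f.eval x < g.eval x
  le_refl f := Or.inl rfl
  le_trans f g h hfg hgh := by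
    rcases hfg with rfl | hfg
    · exact hgh
    · rcases hgh with rfl | hgh
      · exact Or.inr hfg
      · exact Or.inr fun x => (hfg x).trans (hgh x)
  le_antisymm f g hfg hgf := by
    rcases hfg with rfl | hfg
    · rfl
    · rcases hgf with rfl | hgf
      · rfl
      · exact StrictlyOrdered.ext fun x => absurd (hfg x) (hgf x).asymm

end Simplices

/-! ### Linearly independent families and the subgroups they generate -/

section IntegerSpans

/-! `G` is the integer span of a real-linearly independent family in `Aff K` that contains the
constant 1 and whose integer span is dense; infinite dimensionality leaves room for both properties
at once. Freeness is immediate, and a finitely generated subgroup is discrete because it lies in a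
finite-dimensional space, where its integer coordinates are continuous.

The order structure uses only density and the constant 1. Hahn-Banach and Riesz decomposition in the
cone over the simplex give strict interpolation in `Aff K`, and a compactness margin moves the
interpolant into `G`. Separation by integer combinations and compactness show that every trace is a
point evaluation.

For Anti-FD, one stage of a pro-fd group suffices. Its finitely many pure traces are mutually
singular, so approximate divisibility makes the stage dense in some `ℝⁿ` (`denseRange_pureEval`). A
continuous homomorphism to `G` extends by completeness to a real-linear map on `ℝⁿ`. Each coordinate
of that map is a linear functional on `ℝⁿ`, hence continuous; being integral on a dense set it is
integral everywhere, hence zero (`eq_zero_of_denseRange_of_mem_span_int`). -/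

/-- In a vanishing combination, the functional at an index of maximal rank in the support sees only
its own term. Ranks may tie, so `hoff` includes equal ranks. -/
theorem linearIndependent_of_triangular {ι X : Type*} [AddCommGroup X] [Module ℝ X]
    (b : ι → X) (f : ι → X →ₗ[ℝ] ℝ) (rank : ι → ℕ) (hdiag : ∀ i, f i (b i) ≠ 0)
    (hoff : ∀ i j, j ≠ i → rank j ≤ rank i → f i (b j) = 0) : LinearIndependent ℝ b := by
  rw [linearIndependent_iff]
  intro l hl
  by_contra hne
  obtain ⟨i, hi, hmax⟩ := l.support.exists_max_image rank (Finsupp.support_nonempty_iff.2 hne)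
  have h := congrArg (f i) hl
  rw [Finsupp.linearCombination_apply, Finsupp.sum, map_sum, map_zero,
    Finset.sum_eq_single_of_mem i hi] at h
  · simp only [map_smul, smul_eq_mul, mul_eq_zero] at h
    exact h.elim (Finsupp.mem_support_iff.1 hi) (hdiag i)
  · intro j hj hji
    rw [map_smul, hoff i j hji (hmax j hj), smul_zero]

/-- An infinite basis has as many elements as its product with `ℕ`. The rows are sequences in which
countable constructions can run, so `X` need not be separable. -/
theorem exists_basis_prod_nat {X : Type u} [AddCommGroup X] [Module ℝ X]
    (hX : ¬ FiniteDimensional ℝ X) {x₀ : X} (hx₀ : x₀ ≠ 0) :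
    ∃ (ι : Type u) (e : Module.Basis (ι × ℕ) ℝ X) (i : ι), e (i, 0) = x₀ := by
  classical
  have hli : LinearIndepOn ℝ id ({x₀} : Set X) := LinearIndepOn.singleton hx₀
  let e₀ := Module.Basis.extend hli
  have hinf : Infinite (hli.extend (Set.subset_univ _)) := by
    by_contra h
    rw [not_infinite_iff_finite] at h
    exact hX (Module.Finite.of_basis e₀)
  let ι := hli.extend (Set.subset_univ _)
  obtain ⟨s⟩ : Nonempty (ι ≃ ι × ℕ) := by
    rw [← Cardinal.eq]
    simp [Cardinal.aleph0_le_mk]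
  have hmem : x₀ ∈ hli.extend (Set.subset_univ _) :=
    hli.subset_extend (Set.subset_univ _) rfl
  let i₀ : ι := ⟨x₀, hmem⟩
  -- The swap moves `x₀` to the start of its row, the one position that the later construction
  -- leaves unchanged.
  let s' := s.trans (Equiv.swap (s i₀) ((s i₀).1, 0))
  refine ⟨ι, e₀.reindex s', (s i₀).1, ?_⟩
  have : s'.symm ((s i₀).1, 0) = i₀ := by
    rw [Equiv.symm_apply_eq]
    simp [s']
  rw [Module.Basis.reindex_apply, this]
  simp [e₀, i₀]

/-- Each row is replaced by vectors `q k • e (i, m)` plus a small multiple of a new basis vector.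
The new vector keeps the family independent; letting its multiple shrink puts every `q k • e (i, m)`
in the closure of the span. -/
theorem exists_linearIndependent_dense_span_int {X : Type u} [NormedAddCommGroup X]
    [NormedSpace ℝ X] (hX : ¬ FiniteDimensional ℝ X) {x₀ : X} (hx₀ : x₀ ≠ 0) :
    ∃ (κ : Type u) (b : κ → X), LinearIndependent ℝ b ∧ x₀ ∈ Set.range b ∧
      Dense (Submodule.span ℤ (Set.range b) : Set X) := by
  classical
  obtain ⟨ι, e, i₀, he⟩ := exists_basis_prod_nat hX hx₀
  let q : ℕ → ℝ := TopologicalSpace.denseSeq ℝ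
  have hq : DenseRange q := TopologicalSpace.denseRange_denseSeq ℝ
  let ε : ι → ℕ → ℕ → ℝ := fun i j N => (1 / 2) ^ j / (‖e (i, N)‖ + 1)
  have hε : ∀ i j N, 0 < ε i j N := fun i j N => by positivity
  -- `N` encodes a triple `(m, k, j)`: row position, rational-like scalar `q k`, and precision `(1 /
  -- 2) ^ j`. Since `m ≤ N`, the vector `e (i, N + 1)` is new at this step.
  let c : ι → ℕ → X := fun i N => Nat.rec (e (i, 0))
    (fun N _ => q N.unpair.2.unpair.1 • e (i, N.unpair.1) +
      ε i N.unpair.2.unpair.2 (N + 1) • e (i, N + 1)) N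
  have hc0 : ∀ i, c i 0 = e (i, 0) := fun i => rfl
  have hc : ∀ i N, c i (N + 1) = q N.unpair.2.unpair.1 • e (i, N.unpair.1) +
      ε i N.unpair.2.unpair.2 (N + 1) • e (i, N + 1) := fun i N => rfl
  let b : ι × ℕ → X := fun p => c p.1 p.2
  have hcoord : ∀ p p' : ι × ℕ, e.coord p (e p') = if p' = p then 1 else 0 := by
    intro p p'
    simp [Finsupp.single_apply]
  refine ⟨ι × ℕ, b, ?_, ⟨(i₀, 0), by simp [b, hc0, he]⟩, ?_⟩
  · refine linearIndependent_of_triangular b e.coord Prod.snd ?_ ?_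
    · rintro ⟨i, N⟩
      cases N with
      | zero => simp only [b, hc0, hcoord]; simp
      | succ N =>
        have h1 : N.unpair.1 ≠ N + 1 := (Nat.lt_succ_of_le (Nat.unpair_left_le N)).ne
        simp only [b, hc, map_add, map_smul, hcoord]
        simp [h1, (hε _ _ _).ne']
    · rintro ⟨i, N⟩ ⟨i', M⟩ hne hle
      simp only at hle
      cases M with
      | zero =>
        simp only [b, hc0, hcoord, if_neg hne]
      | succ M =>
        have h1 : M.unpair.1 ≠ N := by
          have := Nat.unpair_left_le M
          omega
        simp only [b, hc, map_add, map_smul, hcoord, if_neg hne]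
        simp [h1]
  · let Γ : AddSubgroup X := (Submodule.span ℤ (Set.range b)).toAddSubgroup.topologicalClosure
    have hΓc : IsClosed (Γ : Set X) := AddSubgroup.isClosed_topologicalClosure _
    have hbΓ : ∀ p, b p ∈ Γ := fun p =>
      AddSubgroup.le_topologicalClosure _ (Submodule.subset_span ⟨p, rfl⟩)
    have hqe : ∀ i m k, q k • e (i, m) ∈ Γ := by
      intro i m k
      have hlim : Filter.Tendsto (fun j => b (i, Nat.pair m (Nat.pair k j) + 1)) Filter.atTop
          (nhds (q k • e (i, m))) := by
        rw [tendsto_iff_norm_sub_tendsto_zero]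
        refine squeeze_zero (fun _ => norm_nonneg _) (g := fun j => (1 / 2 : ℝ) ^ j) ?_
          (tendsto_pow_atTop_nhds_zero_of_lt_one (by norm_num) (by norm_num))
        intro j
        simp only [b, hc, Nat.unpair_pair, add_sub_cancel_left, norm_smul]
        rw [Real.norm_of_nonneg (hε _ _ _).le]
        simp only [ε]
        rw [div_mul_eq_mul_div, div_le_iff₀ (by positivity)]
        gcongr
        linarith
      exact hΓc.mem_of_tendsto hlim (Filter.Eventually.of_forall fun j =>
        SetLike.mem_coe.2 (hbΓ (i, Nat.pair m (Nat.pair k j) + 1)))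
    have hre : ∀ (p : ι × ℕ) (r : ℝ), r • e p ∈ Γ := by
      rintro ⟨i, m⟩ r
      have hcl : IsClosed {r : ℝ | r • e (i, m) ∈ Γ} :=
        hΓc.preimage (continuous_id.smul continuous_const)
      have := hcl.closure_subset_iff.2 (Set.range_subset_iff.2 fun k => hqe i m k)
      exact this (hq r)
    intro x
    have hx : x ∈ Γ := by
      rw [← e.linearCombination_repr x, Finsupp.linearCombination_apply, Finsupp.sum]
      exact sum_mem fun p _ => hre p _
    exact hx

/-- The coordinate functionals of a linearly independent family, extended to the whole space. -/
theorem exists_coordinate_functionals {κ X : Type*} [AddCommGroup X] [Module ℝ X] {b : κ → X}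
    (hb : LinearIndependent ℝ b) :
    ∃ ℓ : κ → X →ₗ[ℝ] ℝ,
      (∀ x ∈ Submodule.span ℤ (Set.range b), ∀ i, ∃ n : ℤ, ℓ i x = n) ∧
      (∀ x ∈ Submodule.span ℤ (Set.range b), (∀ i, ℓ i x = 0) → x = 0) ∧
      (∀ i j, j ≠ i → ℓ i (b j) = 0) := by
  classical
  -- The extensions are purely algebraic and need not be continuous on `X`.
  choose ℓ hℓ using fun i => LinearMap.exists_extend ((Finsupp.lapply i).comp hb.repr)
  have hval : ∀ i (x : X) (hx : x ∈ Submodule.span ℝ (Set.range b)),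
      ℓ i x = hb.repr ⟨x, hx⟩ i := fun i x hx => LinearMap.congr_fun (hℓ i) ⟨x, hx⟩
  have hbv : ∀ i j, ℓ i (b j) = if j = i then 1 else 0 := by
    intro i j
    rw [hval i (b j) (Submodule.subset_span ⟨j, rfl⟩),
      hb.repr_eq_single j _ rfl, Finsupp.single_apply]
  refine ⟨ℓ, ?_, ?_, fun i j hji => by rw [hbv, if_neg hji]⟩
  · intro x hx i
    induction hx using Submodule.span_induction with
    | mem x hx =>
      obtain ⟨j, rfl⟩ := hx
      refine ⟨if j = i then 1 else 0, ?_⟩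
      rw [hbv]; split_ifs <;> simp
    | zero => exact ⟨0, by simp⟩
    | add x y _ _ hx hy =>
      obtain ⟨n, hn⟩ := hx
      obtain ⟨m, hm⟩ := hy
      exact ⟨n + m, by simp [hn, hm]⟩
    | smul a x _ hx =>
      obtain ⟨n, hn⟩ := hx
      exact ⟨a * n, by simp [hn]⟩
  · intro x hx h
    have hx' : x ∈ Submodule.span ℝ (Set.range b) :=
      Submodule.span_le_restrictScalars ℤ ℝ _ hx
    have : hb.repr ⟨x, hx'⟩ = 0 := Finsupp.ext fun i => by rw [← hval, h]; rfl
    have h0 := hb.linearCombination_repr ⟨x, hx'⟩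
    rw [this, map_zero] at h0
    exact h0.symm

/-- On the finite-dimensional real span of the generators the coordinates are continuous. Finitely
many of them determine an element of the subgroup, and integers of absolute value below 1 vanish. -/
theorem discreteTopology_of_fg_of_le_span_int {κ X : Type*} [NormedAddCommGroup X]
    [NormedSpace ℝ X] {b : κ → X} (hb : LinearIndependent ℝ b) (S : AddSubgroup X)
    (hS : S ≤ (Submodule.span ℤ (Set.range b)).toAddSubgroup) (hfg : S.FG) :
    DiscreteTopology S := by
  classical
  obtain ⟨ℓ, hint, hinj, hoff⟩ := exists_coordinate_functionals hb
  obtain ⟨F, rfl⟩ := hfg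
  let V : Submodule ℝ X := Submodule.span ℝ (F : Set X)
  have hV : FiniteDimensional ℝ V := FiniteDimensional.span_finset ℝ F
  have hSV : ∀ x ∈ AddSubgroup.closure (F : Set X), x ∈ V := by
    intro x hx
    exact (AddSubgroup.closure_le V.toAddSubgroup).2 Submodule.subset_span hx
  have hsupp : ∀ x ∈ Submodule.span ℤ (Set.range b), ∃ T : Finset κ, ∀ i ∉ T, ℓ i x = 0 := by
    intro x hx
    obtain ⟨c, rfl⟩ := (Finsupp.mem_span_range_iff_exists_finsupp).1 hx
    refine ⟨c.support, fun i hi => ?_⟩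
    rw [Finsupp.sum, map_sum]
    refine Finset.sum_eq_zero fun j hj => ?_
    rw [map_zsmul, hoff i j (by rintro rfl; exact hi hj), smul_zero]
  choose! T hT using hsupp
  let U : Finset κ := F.biUnion T
  have hU : ∀ x ∈ AddSubgroup.closure (F : Set X), ∀ i ∉ U, ℓ i x = 0 := by
    intro x hx i hi
    have : AddSubgroup.closure (F : Set X) ≤ (ℓ i).toAddMonoidHom.ker := by
      rw [AddSubgroup.closure_le]
      intro y hy
      refine hT y (hS (AddSubgroup.subset_closure hy)) i fun hiy => hi ?_
      exact Finset.mem_biUnion.2 ⟨y, hy, hiy⟩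
    exact this hx
  let f : V →ₗ[ℝ] (U → ℝ) := LinearMap.pi fun i => (ℓ i).comp V.subtype
  have hf : Continuous f := f.continuous_of_finiteDimensional
  refine discreteTopology_of_isOpen_singleton_zero ?_
  let j : AddSubgroup.closure (F : Set X) → V := fun x => ⟨x, hSV x x.2⟩
  have hj : Continuous j := continuous_subtype_val.subtype_mk _
  convert (Metric.isOpen_ball (x := (0 : U → ℝ)) (ε := 1)).preimage (hf.comp hj)
  ext x
  simp only [Set.mem_singleton_iff, Set.mem_preimage, Function.comp, mem_ball_zero_iff,
    pi_norm_lt_iff one_pos]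
  constructor
  · rintro rfl i
    simp [f, j]
  · intro h
    refine Subtype.ext (hinj x (hS x.2) fun i => ?_)
    by_cases hi : i ∈ U
    · have h1 := h ⟨i, hi⟩
      obtain ⟨n, hn⟩ := hint x (hS x.2) i
      have h2 : f (j x) ⟨i, hi⟩ = n := hn
      rw [h2, Real.norm_eq_abs, ← Int.cast_abs] at h1
      have h3 : |n| < 1 := by exact_mod_cast h1
      rw [hn, Int.abs_lt_one_iff.1 h3, Int.cast_zero]
    · exact hU x x.2 i hi

/-- A homomorphism into the integer span of a linearly independent family vanishes if it is
continuous for the topology induced by a map with dense range in a finite-dimensional space. -/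
theorem eq_zero_of_denseRange_of_mem_span_int {κ ι G X : Type*} [Fintype ι] [AddCommGroup G]
    [NormedAddCommGroup X] [NormedSpace ℝ X] [CompleteSpace X] {b : κ → X}
    (hb : LinearIndependent ℝ b) (P : G →+ (ι → ℝ)) (hP : DenseRange P) (ψ : G →+ X)
    (hψ : ∀ g, ψ g ∈ Submodule.span ℤ (Set.range b))
    (hc : ∀ ε > 0, ∃ δ > 0, ∀ g, ‖P g‖ < δ → ‖ψ g‖ < ε) : ψ = 0 := by
  obtain ⟨ℓ, hint, hinj, -⟩ := exists_coordinate_functionals hb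
  -- With the seminorm pulled back along `P`, the map `P` is a dense uniform embedding up to
  -- separation and `ψ` is continuous, so `ψ` extends to `ι → ℝ`. Additivity and continuity then
  -- give real linearity.
  let _ : SeminormedAddCommGroup G := SeminormedAddCommGroup.induced G (ι → ℝ) P
  have hnorm : ∀ g : G, ‖g‖ = ‖P g‖ := fun g => rfl
  have hPi : IsUniformInducing P := ⟨rfl⟩
  have hψc : Continuous ψ := by
    refine continuous_of_continuousAt_zero ψ ?_
    rw [ContinuousAt, map_zero, Metric.tendsto_nhds_nhds]
    intro ε hε
    obtain ⟨δ, hδ, h⟩ := hc ε hε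
    refine ⟨δ, hδ, fun {g} hg => ?_⟩
    rw [dist_zero_right] at hg ⊢
    exact h g hg
  let PL : G →L[ℤ] (ι → ℝ) := ⟨P.toIntLinearMap, hPi.uniformContinuous.continuous⟩
  let ψL : G →L[ℤ] X := ⟨ψ.toIntLinearMap, hψc⟩
  let Ψ₀ : (ι → ℝ) →L[ℤ] X := ψL.extend PL
  have hΨ₀ : ∀ g, Ψ₀ (P g) = ψ g := fun g =>
    ContinuousLinearMap.extend_eq ψL (e := PL) hP hPi g
  let Ψ : (ι → ℝ) →L[ℝ] X := Ψ₀.toLinearMap.toAddMonoidHom.toRealLinearMap Ψ₀.continuous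
  have hΨ : ∀ g, Ψ (P g) = ψ g := hΨ₀
  ext g
  refine hinj _ (hψ g) fun i => ?_
  let L : (ι → ℝ) →ₗ[ℝ] ℝ := (ℓ i).comp Ψ.toLinearMap
  have hL : Continuous L := L.continuous_of_finiteDimensional
  have hcl : IsClosed {v | L v ∈ Set.range ((↑) : ℤ → ℝ)} :=
    Int.isClosedEmbedding_coe_real.isClosed_range.preimage hL
  have hall : ∀ v, ∃ n : ℤ, L v = n := by
    intro v
    have := hcl.closure_subset_iff.2 (Set.range_subset_iff.2 fun g => ?_) (hP v)
    · obtain ⟨n, hn⟩ := this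
      exact ⟨n, hn.symm⟩
    · obtain ⟨n, hn⟩ := hint _ (hψ g) i
      refine ⟨n, ?_⟩
      rw [← hn, ← hΨ g]
      rfl
  have hLg : L (P g) = ℓ i (ψ g) := by rw [← hΨ g]; rfl
  rw [← hLg]
  by_contra hne
  -- The rescaled vector has `L`-value `1 / 2`, which is not an integer.
  obtain ⟨n, hn⟩ := hall ((1 / (2 * L (P g))) • P g)
  rw [map_smul, smul_eq_mul] at hn
  have h2 : (1 : ℝ) / 2 = n := by rw [← hn]; field_simp
  have h3 : (1 : ℝ) = ((2 * n : ℤ) : ℝ) := by push_cast; linarith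
  have h4 : (1 : ℤ) = 2 * n := by exact_mod_cast h3
  omega

end IntegerSpans

/-! ### Traces on dimension groups -/

section DimensionGroups

variable {G : Type u} [AddCommGroup G] [PartialOrder G]

/-! ### Riesz decomposition and infima of positive homomorphisms -/

theorem IsDimensionGroup.exists_riesz_decomposition (hG : IsDimensionGroup G) {y x₁ x₂ : G}
    (hy : 0 ≤ y) (hx₁ : 0 ≤ x₁) (hx₂ : 0 ≤ x₂) (h : y ≤ x₁ + x₂) :
    ∃ y₁ y₂ : G, 0 ≤ y₁ ∧ 0 ≤ y₂ ∧ y₁ ≤ x₁ ∧ y₂ ≤ x₂ ∧ y = y₁ + y₂ := by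
  have := hG.isOrderedAddMonoid
  obtain ⟨z, h1, h2, h3, h4⟩ := hG.interpolation 0 (y - x₂) y x₁ hy hx₁
    (sub_le_self y hx₂) (sub_le_iff_le_add.2 h)
  exact ⟨z, y - z, h1, sub_nonneg.2 h3, h4, sub_le_comm.1 h2, by abel⟩

/-- The extension is `h p - h (p - x)` for an upper bound `p` of `0` and `x`; `key` shows that the
choice of `p` does not matter. -/
theorem IsDimensionGroup.exists_addMonoidHom_extending (hG : IsDimensionGroup G) (h : G → ℝ)
    (hadd : ∀ x y, 0 ≤ x → 0 ≤ y → h (x + y) = h x + h y) :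
    ∃ H : G →+ ℝ, ∀ x, 0 ≤ x → H x = h x := by
  have := hG.isOrderedAddMonoid
  choose p hp using fun x => hG.directed 0 x
  have key : ∀ x q, 0 ≤ q → x ≤ q → h (p x) - h (p x - x) = h q - h (q - x) := by
    intro x q hq hxq
    have h1 := hadd q (p x - x) hq (sub_nonneg.2 (hp x).2)
    have h2 := hadd (p x) (q - x) (hp x).1 (sub_nonneg.2 hxq)
    have h3 : q + (p x - x) = p x + (q - x) := by abel
    rw [h3] at h1
    linarith
  refine ⟨AddMonoidHom.mk' (fun x => h (p x) - h (p x - x)) ?_, ?_⟩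
  · intro x y
    have h1 := key (x + y) (p x + p y) (add_nonneg (hp x).1 (hp y).1)
      (add_le_add (hp x).2 (hp y).2)
    have h2 : p x + p y - (x + y) = (p x - x) + (p y - y) := by abel
    rw [h1, h2, hadd _ _ (hp x).1 (hp y).1,
      hadd _ _ (sub_nonneg.2 (hp x).2) (sub_nonneg.2 (hp y).2)]
    ring
  · intro x hx
    have h0 : h 0 = 0 := by simpa using hadd 0 0 le_rfl le_rfl
    have := key x x hx le_rfl
    rw [sub_self, h0, sub_zero] at this
    exact this

/-- The infimum of two positive homomorphisms on a dimension group. -/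
theorem IsDimensionGroup.exists_inf_hom (hG : IsDimensionGroup G) (f g : G →+ ℝ)
    (hf : ∀ x, 0 ≤ x → 0 ≤ f x) (hg : ∀ x, 0 ≤ x → 0 ≤ g x) :
    ∃ h : G →+ ℝ, (∀ x, 0 ≤ x → 0 ≤ h x ∧ h x ≤ f x ∧ h x ≤ g x) ∧
      ∀ a, 0 ≤ a → ∀ ε > 0, ∃ y, 0 ≤ y ∧ y ≤ a ∧ f y + g (a - y) < h a + ε := by
  have := hG.isOrderedAddMonoid
  -- Riesz-Kantorovich formula: the infimum at `x ≥ 0` is the cheapest way to split `x` between `f`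
  -- and `g`. Riesz decomposition gives the superadditive half of additivity.
  let S : G → Set ℝ := fun x => (fun y => f y + g (x - y)) '' Set.Icc 0 x
  have hS0 : ∀ x, ∀ r ∈ S x, 0 ≤ r := by
    rintro x _ ⟨y, hy, rfl⟩
    exact add_nonneg (hf y hy.1) (hg _ (sub_nonneg.2 hy.2))
  have hSb : ∀ x, BddBelow (S x) := fun x => ⟨0, fun r hr => hS0 x r hr⟩
  have hSn : ∀ x, 0 ≤ x → (S x).Nonempty := fun x hx => ⟨_, 0, ⟨le_rfl, hx⟩, rfl⟩
  have hadd : ∀ x y, 0 ≤ x → 0 ≤ y → sInf (S (x + y)) = sInf (S x) + sInf (S y) := by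
    intro x y hx hy
    refine le_antisymm ?_ ?_
    · refine le_of_forall_pos_le_add fun ε hε => ?_
      obtain ⟨_, ⟨a, ha, rfl⟩, ha'⟩ := exists_lt_of_csInf_lt (hSn x hx)
        (lt_add_of_pos_right (sInf (S x)) (half_pos hε))
      obtain ⟨_, ⟨b, hb, rfl⟩, hb'⟩ := exists_lt_of_csInf_lt (hSn y hy)
        (lt_add_of_pos_right (sInf (S y)) (half_pos hε))
      have h1 := csInf_le (hSb (x + y))
        ⟨a + b, ⟨add_nonneg ha.1 hb.1, add_le_add ha.2 hb.2⟩, rfl⟩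
      have h2 : x + y - (a + b) = (x - a) + (y - b) := by abel
      simp only [h2, map_add] at h1
      linarith
    · refine le_csInf (hSn _ (add_nonneg hx hy)) ?_
      rintro _ ⟨c, hc, rfl⟩
      obtain ⟨a, b, ha, hb, hax, hby, rfl⟩ := hG.exists_riesz_decomposition hc.1 hx hy hc.2
      have h1 := csInf_le (hSb x) ⟨a, ⟨ha, hax⟩, rfl⟩
      have h2 := csInf_le (hSb y) ⟨b, ⟨hb, hby⟩, rfl⟩
      have h3 : x + y - (a + b) = (x - a) + (y - b) := by abel
      simp only [h3, map_add]
      linarith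
  obtain ⟨h, hh⟩ := hG.exists_addMonoidHom_extending (fun x => sInf (S x)) hadd
  refine ⟨h, fun x hx => ?_, fun a ha ε hε => ?_⟩
  · rw [hh x hx]
    refine ⟨le_csInf (hSn x hx) (hS0 x), ?_, ?_⟩
    · exact csInf_le (hSb x) ⟨x, ⟨hx, le_rfl⟩, by simp⟩
    · exact csInf_le (hSb x) ⟨0, ⟨le_rfl, hx⟩, by simp⟩
  · obtain ⟨_, ⟨y, hy, rfl⟩, hy'⟩ := exists_lt_of_csInf_lt (hSn a ha)
      (lt_add_of_pos_right (sInf (S a)) hε)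
    exact ⟨y, hy.1, hy.2, by rw [hh a ha]; exact hy'⟩

/-! ### Pure traces and mutual singularity -/

/-- A trace as a bundled homomorphism. -/
def traceHom {e : G} {τ : G → ℝ} (hτ : τ ∈ traceSpace e) : G →+ ℝ :=
  AddMonoidHom.mk' τ hτ.1

theorem traceHom_apply {e : G} {τ : G → ℝ} (hτ : τ ∈ traceSpace e) (g : G) :
    traceHom hτ g = τ g := rfl

theorem eq_zero_of_apply_orderUnit_eq_zero [IsOrderedAddMonoid G] {e : G} (he : IsOrderUnit e)
    (h : G →+ ℝ) (hpos : ∀ x, 0 ≤ x → 0 ≤ h x) (h0 : h e = 0) : h = 0 := by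
  have hmono : ∀ x, h x ≤ 0 := by
    intro x
    obtain ⟨n, hn⟩ := he.2 x
    have := hpos _ (sub_nonneg.2 hn)
    rw [map_sub, map_nsmul, h0, smul_zero] at this
    linarith
  ext x
  have h1 := hmono x
  have h2 := hmono (-x)
  rw [map_neg] at h2
  exact le_antisymm h1 (neg_nonpos.1 h2)

theorem inv_smul_mem_traceSpace {e : G} (h : G →+ ℝ) (hpos : ∀ x, 0 ≤ x → 0 ≤ h x)
    (h0 : 0 < h e) : (h e)⁻¹ • (h : G → ℝ) ∈ traceSpace e := by
  refine ⟨fun x y => ?_, fun x hx => ?_, ?_⟩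
  · simp [mul_add]
  · exact mul_nonneg (inv_nonneg.2 h0.le) (hpos x hx)
  · simp [h0.ne']

/-- A positive homomorphism below a pure trace is a multiple of it. -/
theorem eq_mul_of_le_pureTrace [IsOrderedAddMonoid G] {e : G} (he : IsOrderUnit e) {τ : G → ℝ}
    (hτ : τ ∈ pureTraces e) (h : G →+ ℝ) (hpos : ∀ x, 0 ≤ x → 0 ≤ h x)
    (hle : ∀ x, 0 ≤ x → h x ≤ τ x) (x : G) : h x = h e * τ x := by
  have hτ' : τ ∈ traceSpace e := hτ.1
  let k : G →+ ℝ := traceHom hτ' - h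
  have hk : ∀ x, k x = τ x - h x := fun x => rfl
  have hkpos : ∀ x, 0 ≤ x → 0 ≤ k x := fun x hx => by
    rw [hk]; linarith [hle x hx]
  have hke : k e = 1 - h e := by rw [hk, hτ'.2.2]
  rcases (hpos e he.1).eq_or_lt with h0 | h0
  · have := eq_zero_of_apply_orderUnit_eq_zero he h hpos h0.symm
    simp [this]
  rcases (hkpos e he.1).eq_or_lt with h1 | h1
  · have h2 := eq_zero_of_apply_orderUnit_eq_zero he k hkpos h1.symm
    have h3 : τ x - h x = 0 := by rw [← hk, h2]; rfl
    have h4 : h e = 1 := by linarith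
    rw [h4]; linarith
  -- Here `τ` is a proper convex combination of the normalizations of `h` and `τ - h`, so purity
  -- identifies them with `τ`.
  · have h2 := hτ.2 (inv_smul_mem_traceSpace h hpos h0) (inv_smul_mem_traceSpace k hkpos h1)
      ⟨h e, k e, h0, h1, by rw [hke]; ring, ?_⟩
    · have h3 := congrFun h2 x
      simp only [Pi.smul_apply, smul_eq_mul] at h3
      rw [← h3]; field_simp
    · ext y
      simp only [Pi.add_apply, Pi.smul_apply, smul_eq_mul]
      rw [mul_inv_cancel_left₀ h0.ne', mul_inv_cancel_left₀ h1.ne', hk]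
      ring

/-- Distinct pure traces on a dimension group are mutually singular. -/
theorem exists_decomposition_of_pureTraces_ne (hG : IsDimensionGroup G) {e : G}
    (he : IsOrderUnit e) {σ τ : G → ℝ} (hσ : σ ∈ pureTraces e) (hτ : τ ∈ pureTraces e)
    (hne : σ ≠ τ) {a : G} (ha : 0 ≤ a) {ε : ℝ} (hε : 0 < ε) :
    ∃ y, 0 ≤ y ∧ y ≤ a ∧ σ (a - y) < ε ∧ τ y < ε := by
  have := hG.isOrderedAddMonoid
  obtain ⟨h, hh, hy⟩ := hG.exists_inf_hom (traceHom hτ.1) (traceHom hσ.1) hτ.1.2.1 hσ.1.2.1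
  have h1 := eq_mul_of_le_pureTrace he hτ h (fun x hx => (hh x hx).1) (fun x hx => (hh x hx).2.1)
  have h2 := eq_mul_of_le_pureTrace he hσ h (fun x hx => (hh x hx).1) (fun x hx => (hh x hx).2.2)
  -- The infimum is `h e` times each of the two traces, so it vanishes when they differ. A nearly
  -- optimal splitting of `a` is then the required one.
  have h0 : h e = 0 := by
    by_contra h0
    refine hne (funext fun x => mul_left_cancel₀ h0 ?_)
    rw [← h1, ← h2]
  obtain ⟨y, hy0, hya, hlt⟩ := hy a ha ε hε
  rw [h1 a, h0, zero_mul, zero_add, traceHom_apply, traceHom_apply] at hlt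
  have h3 := hτ.1.2.1 y hy0
  have h4 := hσ.1.2.1 (a - y) (sub_nonneg.2 hya)
  exact ⟨y, hy0, hya, by linarith, by linarith⟩

/-- The traces in `s` are handled one at a time. Shrinking `y` further does not spoil the bounds
already obtained, and costs `σ` at most another `ε / 2`. -/
theorem exists_decomposition_of_finset_pureTraces (hG : IsDimensionGroup G) {e : G}
    (he : IsOrderUnit e) {σ : G → ℝ} (hσ : σ ∈ pureTraces e) (s : Finset (G → ℝ))
    (hs : ∀ τ ∈ s, τ ∈ pureTraces e ∧ σ ≠ τ) {a : G} (ha : 0 ≤ a) {ε : ℝ} (hε : 0 < ε) :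
    ∃ y, 0 ≤ y ∧ y ≤ a ∧ σ (a - y) < ε ∧ ∀ τ ∈ s, τ y < ε := by
  classical
  have := hG.isOrderedAddMonoid
  induction s using Finset.induction_on generalizing ε with
  | empty =>
    refine ⟨a, ha, le_rfl, ?_, by simp⟩
    rw [sub_self, ← traceHom_apply hσ.1, map_zero]
    exact hε
  | insert τ s hτs ih =>
    obtain ⟨y, hy0, hya, hσy, hsy⟩ := ih (fun τ' hτ' => hs τ' (Finset.mem_insert_of_mem hτ'))
      (half_pos hε)
    obtain ⟨hτ, hne⟩ := hs τ (Finset.mem_insert_self _ _)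
    obtain ⟨z, hz0, hzy, hσz, hτz⟩ :=
      exists_decomposition_of_pureTraces_ne hG he hσ hτ hne hy0 (half_pos hε)
    refine ⟨z, hz0, hzy.trans hya, ?_, ?_⟩
    · have h1 : a - z = (a - y) + (y - z) := by abel
      rw [h1, hσ.1.1]
      linarith
    · intro τ' hτ'
      rcases Finset.mem_insert.1 hτ' with rfl | hτ's
      · linarith
      · have h1 := (hs τ' hτ').1.1.2.1 _ (sub_nonneg.2 hzy)
        have h2 := (hs τ' hτ').1.1.1 z (y - z)
        rw [add_sub_cancel] at h2
        linarith [hsy τ' hτ's]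

/-- The evaluation of group elements at the pure traces. -/
def pureEval (e : G) : G →+ (pureTraces e → ℝ) :=
  AddMonoidHom.mk' (fun g τ => (τ : G → ℝ) g) fun x y => funext fun τ => τ.2.1.1 x y

theorem pureEval_apply (e g : G) (τ : pureTraces e) : pureEval e g τ = (τ : G → ℝ) g := rfl

/-- An approximately divisible dimension group with finitely many pure traces is dense in the
space of functions on its pure traces. -/
theorem denseRange_pureEval (hG : IsDimensionGroup G) {e : G} (he : IsOrderUnit e)
    (hd : IsApproximatelyDivisible e) [Fintype (pureTraces e)] : DenseRange (pureEval e) := by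
  classical
  have := hG.isOrderedAddMonoid
  let Γ : AddSubgroup (pureTraces e → ℝ) := (pureEval e).range.topologicalClosure
  have hsingle : ∀ (σ : pureTraces e) (r : ℝ), Pi.single σ r ∈ Γ := by
    intro σ r
    refine Metric.mem_closure_iff.2 fun ε hε => ?_
    -- Approximate `r` by `σ g`, write `g` as the difference of the positive elements `a` and `a -
    -- g`, and cut each down to a part that almost keeps its value at `σ` and is small at the other
    -- pure traces.
    obtain ⟨_, ⟨g, rfl⟩, hg⟩ := Metric.mem_closure_iff.1 (hd σ σ.2 r) (ε / 4) (by positivity)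
    obtain ⟨a, ha0, hga⟩ := hG.directed 0 g
    let s : Finset (G → ℝ) := (Finset.univ.erase σ).map (Function.Embedding.subtype _)
    have hs : ∀ τ ∈ s, τ ∈ pureTraces e ∧ (σ : G → ℝ) ≠ τ := by
      intro τ hτ
      obtain ⟨τ', hτ', rfl⟩ := Finset.mem_map.1 hτ
      exact ⟨τ'.2, fun h => (Finset.mem_erase.1 hτ').1 (Subtype.ext h.symm)⟩
    have hms : ∀ τ : pureTraces e, τ ≠ σ → (τ : G → ℝ) ∈ s := fun τ hτ =>
      Finset.mem_map.2 ⟨τ, Finset.mem_erase.2 ⟨hτ, Finset.mem_univ _⟩, rfl⟩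
    obtain ⟨y, hy0, hya, hσy, hsy⟩ :=
      exists_decomposition_of_finset_pureTraces hG he σ.2 s hs ha0
        (show 0 < ε / 4 by positivity)
    obtain ⟨z, hz0, hzb, hσz, hsz⟩ :=
      exists_decomposition_of_finset_pureTraces hG he σ.2 s hs (sub_nonneg.2 hga)
        (show 0 < ε / 4 by positivity)
    refine ⟨pureEval e (y - z), ⟨_, rfl⟩, ?_⟩
    rw [dist_pi_lt_iff hε]
    intro τ
    have hτ : ∀ x, traceHom τ.2.1 x = (τ : G → ℝ) x := fun x => rfl
    rw [pureEval_apply, Real.dist_eq, ← hτ, map_sub, hτ, hτ]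
    by_cases hτσ : τ = σ
    · subst hτσ
      rw [Pi.single_eq_same]
      rw [Real.dist_eq] at hg
      have h1 := τ.2.1.2.1 _ (sub_nonneg.2 hya)
      have h2 := τ.2.1.2.1 _ (sub_nonneg.2 hzb)
      rw [← hτ, map_sub, hτ, hτ] at hσy h1
      rw [← hτ, map_sub, map_sub, hτ, hτ, hτ] at hσz h2
      rw [abs_lt] at hg ⊢
      constructor <;> linarith
    · rw [Pi.single_eq_of_ne hτσ]
      have h1 := hsy τ (hms τ hτσ)
      have h2 := hsz τ (hms τ hτσ)
      have h3 := τ.2.1.2.1 y hy0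
      have h4 := τ.2.1.2.1 z hz0
      rw [abs_lt]
      constructor <;> linarith
  intro v
  have hv : v ∈ Γ := by
    rw [← Finset.univ_sum_single v]
    exact sum_mem fun σ _ => hsingle σ _
  exact hv

/-! ### Compactness of the trace space and norm estimates -/

theorem isCompact_traceSpace [IsOrderedAddMonoid G] {e : G} (he : IsOrderUnit e) :
    IsCompact (traceSpace e) := by
  choose n hn using he.2
  refine (isCompact_univ_pi fun g => isCompact_Icc (a := -(n (-g) : ℝ))
    (b := (n g : ℝ))).of_isClosed_subset ?_ ?_
  · have : traceSpace e = (⋂ x : G, ⋂ y : G, {τ : G → ℝ | τ (x + y) = τ x + τ y}) ∩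
        ((⋂ x : G, ⋂ _ : 0 ≤ x, {τ : G → ℝ | 0 ≤ τ x}) ∩ {τ : G → ℝ | τ e = 1}) := by
      ext τ
      simp [traceSpace]
    rw [this]
    refine (isClosed_iInter fun x => isClosed_iInter fun y => isClosed_eq (by fun_prop)
      (by fun_prop)).inter ((isClosed_iInter fun x => isClosed_iInter fun _ =>
      isClosed_le (by fun_prop) (by fun_prop)).inter (isClosed_eq (by fun_prop) (by fun_prop)))
  · intro τ hτ g _
    have key : ∀ x, τ x ≤ n x := by
      intro x
      have h1 := hτ.2.1 _ (sub_nonneg.2 (hn x))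
      rw [← traceHom_apply hτ, map_sub, map_nsmul, traceHom_apply, traceHom_apply, hτ.2.2] at h1
      simpa using h1
    have h2 := key (-g)
    rw [← traceHom_apply hτ, map_neg, traceHom_apply] at h2
    exact ⟨by linarith, key g⟩

theorem convex_traceSpace (e : G) : Convex ℝ (traceSpace e) := by
  intro σ hσ τ hτ a b ha hb hab
  refine ⟨fun x y => ?_, fun x hx => ?_, ?_⟩
  · simp only [Pi.add_apply, Pi.smul_apply, smul_eq_mul, hσ.1, hτ.1]
    ring
  · exact add_nonneg (mul_nonneg ha (hσ.2.1 x hx)) (mul_nonneg hb (hτ.2.1 x hx))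
  · simp [hσ.2.2, hτ.2.2, hab]

/-- Krein-Milman: the bound is a closed convex condition on the trace and holds at the pure ones. -/
theorem abs_trace_le_norm_pureEval [IsOrderedAddMonoid G] {e : G} (he : IsOrderUnit e)
    [Fintype (pureTraces e)] {σ : G → ℝ} (hσ : σ ∈ traceSpace e) (g : G) :
    |σ g| ≤ ‖pureEval e g‖ := by
  have hcl : IsClosed {τ : G → ℝ | |τ g| ≤ ‖pureEval e g‖} :=
    isClosed_le (by fun_prop) continuous_const
  have hcv : Convex ℝ {τ : G → ℝ | |τ g| ≤ ‖pureEval e g‖} := by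
    intro τ₁ h₁ τ₂ h₂ a b ha hb hab
    simp only [Set.mem_ofPred_eq, Pi.add_apply, Pi.smul_apply, smul_eq_mul] at h₁ h₂ ⊢
    calc |a * τ₁ g + b * τ₂ g| ≤ |a * τ₁ g| + |b * τ₂ g| := abs_add_le _ _
      _ = a * |τ₁ g| + b * |τ₂ g| := by rw [abs_mul, abs_mul, abs_of_nonneg ha, abs_of_nonneg hb]
      _ ≤ a * ‖pureEval e g‖ + b * ‖pureEval e g‖ := by gcongr
      _ = ‖pureEval e g‖ := by rw [← add_mul, hab, one_mul]
  have hKM := closure_convexHull_extremePoints (isCompact_traceSpace he) (convex_traceSpace e)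
  rw [← hKM] at hσ
  refine closure_minimal (convexHull_min ?_ hcv) hcl hσ
  intro τ hτ
  exact norm_le_pi_norm (pureEval e g) ⟨τ, hτ⟩

/-- A trace of `H` pulls back along `f` to a positive homomorphism of mass at most `n`, which is
zero or a multiple of a trace of `G`. This turns continuity on a limit into continuity on each
stage. -/
theorem pseudoNorm_map_le [IsOrderedAddMonoid G] {H : Type v} [AddCommGroup H] [PartialOrder H]
    {e : G} (he : IsOrderUnit e) [Fintype (pureTraces e)] {w : H} (f : G →+ H)
    (hf : ∀ g, 0 ≤ g → 0 ≤ f g) [IsOrderedAddMonoid H] {n : ℕ} (hn : f e ≤ n • w) (g : G) :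
    pseudoNorm w (f g) ≤ n * ‖pureEval e g‖ := by
  refine Real.iSup_le ?_ (by positivity)
  rintro ⟨τ, hτ⟩
  let h : G →+ ℝ := (traceHom hτ).comp f
  have hpos : ∀ x, 0 ≤ x → 0 ≤ h x := fun x hx => hτ.2.1 _ (hf x hx)
  have hhn : h e ≤ n := by
    have h1 := hτ.2.1 _ (sub_nonneg.2 hn)
    rw [← traceHom_apply hτ, map_sub, map_nsmul, traceHom_apply hτ w, hτ.2.2] at h1
    change traceHom hτ (f e) ≤ n
    simpa using h1
  change |h g| ≤ _
  rcases (hpos e he.1).eq_or_lt with h0 | h0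
  · rw [eq_zero_of_apply_orderUnit_eq_zero he h hpos h0.symm]
    simp only [AddMonoidHom.zero_apply, abs_zero]
    positivity
  · have h1 := abs_trace_le_norm_pureEval he (inv_smul_mem_traceSpace h hpos h0) g
    simp only [Pi.smul_apply, smul_eq_mul, abs_mul, abs_inv, abs_of_pos h0] at h1
    rw [inv_mul_le_iff₀ h0] at h1
    exact h1.trans (by gcongr)

/-- A continuous homomorphism from a pro-finite dimensional dimension group into the integer span
of a linearly independent family of a Banach space vanishes. -/
theorem IsProFD.hom_eq_zero {H : Type v} [AddCommGroup H] [PartialOrder H] (hH : IsProFD H)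
    {e : H} (he : IsOrderUnit e) {κ X : Type*} [NormedAddCommGroup X] [NormedSpace ℝ X]
    [CompleteSpace X] {b : κ → X} (hb : LinearIndependent ℝ b) (ψ : H →+ X)
    (hψ : ∀ g, ψ g ∈ Submodule.span ℤ (Set.range b))
    (hc : ∀ ε > 0, ∃ δ > 0, ∀ g, pseudoNorm e g < δ → ‖ψ g‖ < ε) : ψ = 0 := by
  obtain ⟨hHd, ⟨D⟩⟩ := hH
  have := hHd.isOrderedAddMonoid
  ext x
  obtain ⟨i, g, rfl⟩ := D.toLim_surjective x
  let _ := D.group i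
  let _ := D.order i
  have := (D.dimensionGroup i).isOrderedAddMonoid
  let _ : Fintype (pureTraces (D.unit i)) := (D.finite_pureTraces i).fintype
  obtain ⟨n, hn⟩ := he.2 (D.toLim i (D.unit i))
  have hpos : ∀ g, 0 ≤ g → 0 ≤ D.toLim i g := fun g hg => (D.nonneg_iff _).2 ⟨i, g, hg, rfl⟩
  have key : ψ.comp (D.toLim i) = 0 := by
    refine eq_zero_of_denseRange_of_mem_span_int hb (pureEval (D.unit i))
      (denseRange_pureEval (D.dimensionGroup i) (D.isOrderUnit i) (D.approximatelyDivisible i))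
      _ (fun g => hψ _) fun ε hε => ?_
    obtain ⟨δ, hδ, h⟩ := hc ε hε
    refine ⟨δ / (n + 1), by positivity, fun g hg => h _ ?_⟩
    refine (pseudoNorm_map_le (D.isOrderUnit i) (D.toLim i) hpos hn g).trans_lt ?_
    rw [lt_div_iff₀ (by positivity)] at hg
    nlinarith [norm_nonneg (pureEval (D.unit i) g)]
  exact DFunLike.congr_fun key g

end DimensionGroups

/-! ### Affine functions on simplices -/

section AffineFunctions

variable {E : Type u} [AddCommGroup E] [Module ℝ E] [TopologicalSpace E] {K : Set E}

theorem Aff.one_apply (x : K) : (Aff.one K : C(K, ℝ)) x = 1 := rfl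

theorem Aff.abs_apply_le_norm [CompactSpace K] (f : Aff K) (x : K) : |(f : C(K, ℝ)) x| ≤ ‖f‖ :=
  (f : C(K, ℝ)).norm_coe_le_norm x

/-- The restriction to `K` of a continuous linear functional. -/
def Aff.restrict (K : Set E) : (E →L[ℝ] ℝ) →ₗ[ℝ] Aff K where
  toFun ℓ := ⟨⟨fun x => ℓ x, by fun_prop⟩, by
    intro x y z a b _ _ _ hz
    simp [hz]⟩
  map_add' _ _ := rfl
  map_smul' _ _ := rfl

theorem Aff.restrict_apply (ℓ : E →L[ℝ] ℝ) (x : K) :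
    (Aff.restrict K ℓ : C(K, ℝ)) x = ℓ x := rfl

/-- Separation of a point from a closed convex set by an integral functional. -/
theorem exists_int_functional_separating {X s : Type*} [Fintype s] (Φ : X → s → ℝ) (v C : s → ℝ)
    (hC : ∀ x g, |Φ x g| ≤ C g) (hconv : Convex ℝ (Set.range Φ)) (hcl : IsClosed (Set.range Φ))
    (hv : v ∉ Set.range Φ) :
    ∃ n : s → ℤ, ∀ x, ∑ g, n g * Φ x g + 1 < ∑ g, n g * v g := by
  classical
  obtain ⟨f, u, hfu, huv⟩ := geometric_hahn_banach_closed_point hconv hcl hv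
  have hf : ∀ w : s → ℝ, f w = ∑ g, f (Pi.single g 1) * w g := by
    intro w
    conv_lhs => rw [← Finset.univ_sum_single w]
    rw [map_sum]
    refine Finset.sum_congr rfl fun g _ => ?_
    have : (Pi.single g (w g) : s → ℝ) = w g • Pi.single g 1 := by
      rw [← Pi.single_smul, smul_eq_mul, mul_one]
    rw [this, map_smul, smul_eq_mul, mul_comm]
  -- Rounding the coefficients of `N * f` down to integers costs at most `∑ g, (C g + |v g|)`; `N`
  -- makes the scaled gap exceed this by more than 1.
  obtain ⟨N, hN⟩ := exists_nat_gt ((∑ g, (C g + |v g|) + 1) / (f v - u))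
  rw [div_lt_iff₀ (by linarith)] at hN
  refine ⟨fun g => ⌊N * f (Pi.single g 1)⌋, fun x => ?_⟩
  have h1 : f (Φ x) < u := hfu _ ⟨x, rfl⟩
  have h2 : N * f v - N * f (Φ x) - (∑ g, ⌊N * f (Pi.single g 1)⌋ * v g -
      ∑ g, ⌊N * f (Pi.single g 1)⌋ * Φ x g) ≤ ∑ g, (C g + |v g|) := by
    rw [hf v, hf (Φ x), Finset.mul_sum, Finset.mul_sum, ← Finset.sum_sub_distrib,
      ← Finset.sum_sub_distrib, ← Finset.sum_sub_distrib]
    refine Finset.sum_le_sum fun g _ => ?_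
    have h3 := Int.floor_le (N * f (Pi.single g 1))
    have h4 := Int.lt_floor_add_one (N * f (Pi.single g 1))
    have h5 : |(N * f (Pi.single g 1) - ⌊N * f (Pi.single g 1)⌋) * (v g - Φ x g)| ≤
        1 * (C g + |v g|) := by
      rw [abs_mul]
      refine mul_le_mul ?_ ?_ (abs_nonneg _) zero_le_one
      · rw [abs_le]
        constructor <;> linarith
      · refine (abs_sub _ _).trans ?_
        linarith [hC x g]
    refine le_trans (le_of_eq ?_) ((le_abs_self _).trans (h5.trans_eq (one_mul _)))
    ring
  have h6 : (N : ℝ) * f (Φ x) ≤ N * u := by gcongr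
  linarith

/-- Normalized positive functionals on a group of affine functions are point evaluations. -/
theorem Aff.exists_eq_eval [CompactSpace K] (hK : Convex ℝ K) (G : AddSubgroup (Aff K))
    (h1 : Aff.one K ∈ G) (τ : G →+ ℝ)
    (hpos : ∀ g : G, (∀ x : K, 0 < (g.1 : C(K, ℝ)) x) → 0 ≤ τ g)
    (hτ : τ ⟨Aff.one K, h1⟩ = 1) :
    ∃ x : K, ∀ g : G, τ g = (g.1 : C(K, ℝ)) x := by
  have hne : (⋂ g : G, {x : K | τ g = (g.1 : C(K, ℝ)) x}).Nonempty := by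
    refine CompactSpace.iInter_nonempty
      (fun g => isClosed_eq continuous_const (ContinuousMap.continuous _)) fun s => ?_
    let Φ : K → s → ℝ := fun x g => (g.1.1 : C(K, ℝ)) x
    have hΦ : Continuous Φ := continuous_pi fun g => ContinuousMap.continuous _
    by_cases hv : (fun g : s => τ g) ∈ Set.range Φ
    · obtain ⟨x, hx⟩ := hv
      refine ⟨x, Set.mem_iInter₂.2 fun g hg => ?_⟩
      exact (congrFun hx ⟨g, hg⟩).symm
    exfalso
    have hconv : Convex ℝ (Set.range Φ) := by
      rintro _ ⟨x, rfl⟩ _ ⟨y, rfl⟩ a b ha hb hab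
      exact ⟨⟨a • (x : E) + b • (y : E), hK x.2 y.2 ha hb hab⟩,
        funext fun g => g.1.1.2 x y _ a b ha hb hab rfl⟩
    obtain ⟨n, hn⟩ := exists_int_functional_separating Φ _ (fun g => ‖g.1.1‖)
      (fun x g => Aff.abs_apply_le_norm g.1.1 x) hconv (isCompact_range hΦ).isClosed hv
    obtain ⟨h, hh⟩ : ∃ h : G, h = ∑ g : s, n g • g.1 := ⟨_, rfl⟩
    have hτh : τ h = ∑ g : s, n g * τ g := by simp [hh, map_sum]
    have hhx : ∀ x : K, (h.1 : C(K, ℝ)) x = ∑ g : s, n g * Φ x g := by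
      intro x
      simp [hh, Φ]
    have hgap : ∀ x : K, (h.1 : C(K, ℝ)) x + 1 < τ h := fun x => by
      rw [hτh, hhx]
      exact hn x
    -- The gap of 1 leaves room for an integer constant: `⌈τ h⌉ - 1` lies strictly above `h` on `K`
    -- but strictly below `τ h`, contradicting positivity of `τ`.
    have hp1 := Int.ceil_lt_add_one (τ h)
    have hp2 := Int.le_ceil (τ h)
    have h3 := hpos ((⌈τ h⌉ - 1) • ⟨Aff.one K, h1⟩ - h) fun x => by
      have h4 : ((((⌈τ h⌉ - 1) • (⟨Aff.one K, h1⟩ : G) - h : G) : Aff K) : C(K, ℝ)) x =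
          (⌈τ h⌉ - 1) - (h.1 : C(K, ℝ)) x := by simp [Aff.one]
      rw [h4]
      linarith [hgap x]
    rw [map_sub, map_zsmul, hτ] at h3
    simp only [zsmul_eq_mul, mul_one] at h3
    push_cast at h3
    linarith
  obtain ⟨x, hx⟩ := hne
  exact ⟨x, fun g => Set.mem_iInter.1 hx g⟩

theorem isOpen_setOf_strictly_positive [CompactSpace K] :
    IsOpen {f : Aff K | ∀ x : K, 0 < (f : C(K, ℝ)) x} := by
  have h := (ContinuousMap.isOpen_setOfPred_mapsTo (X := K) (Y := ℝ) isCompact_univ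
    (isOpen_Ioi (a := (0 : ℝ)))).preimage (continuous_subtype_val (p := (· ∈ Aff K)))
  convert h using 1
  ext f
  simp [Set.MapsTo]

theorem Aff.exists_eq_mul_eval [CompactSpace K] [Nonempty K] (hK : Convex ℝ K)
    (μ : Aff K →ₗ[ℝ] ℝ) (hpos : ∀ g : Aff K, (∀ x : K, 0 < (g : C(K, ℝ)) x) → 0 ≤ μ g) :
    ∃ t : ℝ, 0 ≤ t ∧ ∃ x : K, ∀ g : Aff K, μ g = t * (g : C(K, ℝ)) x := by
  have h0 : 0 ≤ μ (Aff.one K) := hpos _ fun x => zero_lt_one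
  rcases h0.eq_or_lt with h0 | h0
  · refine ⟨0, le_rfl, Classical.arbitrary K, fun g => ?_⟩
    have key : ∀ g, 0 ≤ μ g := by
      intro g
      have h1 := hpos ((‖g‖ + 1) • Aff.one K + g) fun x => by
        have h2 : (((‖g‖ + 1) • Aff.one K + g : Aff K) : C(K, ℝ)) x =
          ‖g‖ + 1 + (g : C(K, ℝ)) x := by simp [Aff.one]
        rw [h2]
        linarith [(abs_le.1 (Aff.abs_apply_le_norm g x)).1]
      rw [map_add, map_smul, ← h0, smul_zero, zero_add] at h1
      exact h1
    have h2 := key (-g)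
    rw [map_neg] at h2
    linarith [key g]
  · obtain ⟨x, hx⟩ := Aff.exists_eq_eval hK ⊤ trivial
      (((μ (Aff.one K))⁻¹ • μ).toAddMonoidHom.comp (AddSubgroup.subtype ⊤))
      (fun g hg => mul_nonneg (inv_nonneg.2 h0.le) (hpos _ hg)) (inv_mul_cancel₀ h0.ne')
    refine ⟨μ (Aff.one K), h0.le, x, fun g => ?_⟩
    have h2 : (μ (Aff.one K))⁻¹ * μ g = (g : C(K, ℝ)) x := hx ⟨g, trivial⟩
    rw [← h2, mul_inv_cancel_left₀ h0.ne']

/-! ### The cone over a simplex and strict interpolation -/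

theorem add_mem_coneOver {E : Type u} [AddCommGroup E] [Module ℝ E] {K : Set E}
    (hK : Convex ℝ K) {a b : E × ℝ} (ha : a ∈ coneOver K)
    (hb : b ∈ coneOver K) : a + b ∈ coneOver K := by
  obtain ⟨t, ht, x, hx, rfl⟩ := ha
  obtain ⟨s, hs, y, hy, rfl⟩ := hb
  rcases (add_nonneg ht hs).eq_or_lt with h0 | h0
  · have ht0 : t = 0 := by linarith
    have hs0 : s = 0 := by linarith
    exact ⟨0, le_rfl, x, hx, by simp [ht0, hs0]⟩
  · refine ⟨t + s, h0.le, (t / (t + s)) • x + (s / (t + s)) • y,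
      hK hx hy (by positivity) (by positivity) (by field_simp), ?_⟩
    simp only [Prod.mk_add_mk, smul_add, smul_smul, mul_div_cancel₀ _ h0.ne']

/-- The piece `c₁₁` plays the role of the infimum of `a₁` and `b₁`. Translating both by `b₂` makes
`a₁` and `b₂` common lower bounds, so all four differences lie in the cone. -/
theorem IsChoquetSimplex.exists_riesz_decomposition (hK : IsChoquetSimplex K)
    {a₁ a₂ b₁ b₂ : E × ℝ} (ha₁ : a₁ ∈ coneOver K) (ha₂ : a₂ ∈ coneOver K)
    (hb₁ : b₁ ∈ coneOver K) (hb₂ : b₂ ∈ coneOver K) (h : a₁ + a₂ = b₁ + b₂) :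
    ∃ c₁₁ ∈ coneOver K, ∃ c₁₂ ∈ coneOver K, ∃ c₂₁ ∈ coneOver K, ∃ c₂₂ ∈ coneOver K,
      a₁ = c₁₁ + c₁₂ ∧ a₂ = c₂₁ + c₂₂ ∧ b₁ = c₁₁ + c₂₁ ∧ b₂ = c₁₂ + c₂₂ := by
  obtain ⟨c, -, h1, h2, h3⟩ := hK.exists_inf (a₁ + b₂) (add_mem_coneOver hK.convex ha₁ hb₂)
    (b₁ + b₂) (add_mem_coneOver hK.convex hb₁ hb₂)
  refine ⟨c - b₂, h3 b₂ hb₂ (by simpa using ha₁) (by simpa using hb₁), a₁ + b₂ - c, h1,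
    b₁ + b₂ - c, h2, c - a₁, h3 a₁ ha₁ (by simpa using hb₂) (by rw [← h]; simpa using ha₂),
    by abel, ?_, by abel, by abel⟩
  rw [← h]; abel

/-- An affine function on `K` extends to the cone by `(t x, t) ↦ t f(x)`, and this extension is
additive. -/
theorem Aff.mul_apply_eq_add (f : Aff K) {t s₁ s₂ : ℝ} {x z₁ z₂ : K} (hs₁ : 0 ≤ s₁)
    (hs₂ : 0 ≤ s₂)
    (h : (t • (x : E), t) = (s₁ • (z₁ : E), s₁) + (s₂ • (z₂ : E), s₂)) :
    t * (f : C(K, ℝ)) x = s₁ * (f : C(K, ℝ)) z₁ + s₂ * (f : C(K, ℝ)) z₂ := by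
  obtain ⟨hx, ht⟩ := Prod.mk.inj h
  simp only at hx ht
  rcases (add_nonneg hs₁ hs₂).eq_or_lt with h0 | h0
  · have h1 : s₁ = 0 := by linarith
    have h2 : s₂ = 0 := by linarith
    simp [ht, h1, h2]
  · have hx' : (x : E) = (s₁ / t) • (z₁ : E) + (s₂ / t) • (z₂ : E) := by
      rw [← ht] at h0
      rw [div_eq_inv_mul, div_eq_inv_mul, mul_smul, mul_smul, ← smul_add, ← hx,
        inv_smul_smul₀ h0.ne']
    rw [← ht] at h0
    rw [f.2 z₁ z₂ x _ _ (by positivity) (by positivity) (by rw [← add_div, ← ht, div_self h0.ne'])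
      hx']
    field_simp

variable [IsTopologicalAddGroup E] [ContinuousSMul ℝ E] [LocallyConvexSpace ℝ E] [T2Space E]

theorem exists_clm_ne {x y : E} (h : x ≠ y) : ∃ ℓ : E →L[ℝ] ℝ, ℓ x ≠ ℓ y := by
  obtain ⟨f, hf⟩ := geometric_hahn_banach_point_point h
  exact ⟨f, hf.ne⟩

/-- Strict interpolation for continuous affine functions on a Choquet simplex. -/
theorem IsChoquetSimplex.exists_strict_interpolation [CompactSpace K] [Nonempty K]
    (hK : IsChoquetSimplex K) (f₁ f₂ g₁ g₂ : Aff K)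
    (h₁₁ : ∀ x : K, (f₁ : C(K, ℝ)) x < (g₁ : C(K, ℝ)) x)
    (h₁₂ : ∀ x : K, (f₁ : C(K, ℝ)) x < (g₂ : C(K, ℝ)) x)
    (h₂₁ : ∀ x : K, (f₂ : C(K, ℝ)) x < (g₁ : C(K, ℝ)) x)
    (h₂₂ : ∀ x : K, (f₂ : C(K, ℝ)) x < (g₂ : C(K, ℝ)) x) :
    ∃ h : Aff K, ∀ x : K, (f₁ : C(K, ℝ)) x < (h : C(K, ℝ)) x ∧
      (f₂ : C(K, ℝ)) x < (h : C(K, ℝ)) x ∧ (h : C(K, ℝ)) x < (g₁ : C(K, ℝ)) x ∧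
      (h : C(K, ℝ)) x < (g₂ : C(K, ℝ)) x := by
  by_contra hcon
  let P : Set (Aff K) := {f | ∀ x : K, 0 < (f : C(K, ℝ)) x}
  have hPo : IsOpen P := isOpen_setOf_strictly_positive
  have hPc : Convex ℝ P := by
    intro f hf g hg a b ha hb hab x
    have h1 : ((a • f + b • g : Aff K) : C(K, ℝ)) x =
      a * (f : C(K, ℝ)) x + b * (g : C(K, ℝ)) x := by simp
    rw [h1]
    rcases ha.eq_or_lt with rfl | ha
    · have : b = 1 := by linarith
      simpa [this] using hg x
    · have := hf x
      have := hg x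
      positivity
  have hPs : ∀ f ∈ P, ∀ t : ℝ, 0 < t → t • f ∈ P := fun f hf t ht x => mul_pos ht (hf x)
  have h1P : Aff.one K ∈ P := fun x => zero_lt_one
  -- An interpolant is an `h` with `T h ∈ U`. If none exists, Hahn-Banach separates the open convex
  -- cone `U` from the affine subspace `Set.range T`.
  let U : Set ((Aff K × Aff K) × (Aff K × Aff K)) := (P ×ˢ P) ×ˢ (P ×ˢ P)
  let T : Aff K → (Aff K × Aff K) × (Aff K × Aff K) := fun h =>
    ((h - f₁, h - f₂), (g₁ - h, g₂ - h))
  have hTc : Convex ℝ (Set.range T) := by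
    rintro _ ⟨h, rfl⟩ _ ⟨k, rfl⟩ a b ha hb hab
    have hb' : b = 1 - a := by linarith
    subst hb'
    refine ⟨a • h + (1 - a) • k, ?_⟩
    simp only [T, Prod.smul_mk, Prod.mk_add_mk, Prod.mk.injEq]
    refine ⟨⟨?_, ?_⟩, ?_, ?_⟩ <;> module
  have hdisj : Disjoint U (Set.range T) := by
    rw [Set.disjoint_left]
    rintro _ hU ⟨h, rfl⟩
    refine hcon ⟨h, fun x => ⟨?_, ?_, ?_, ?_⟩⟩
    · exact sub_pos.1 (hU.1.1 x)
    · exact sub_pos.1 (hU.1.2 x)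
    · exact sub_pos.1 (hU.2.1 x)
    · exact sub_pos.1 (hU.2.2 x)
  obtain ⟨φ, u, hφU, hφT⟩ := geometric_hahn_banach_open ((hPc.prod hPc).prod (hPc.prod hPc))
    ((hPo.prod hPo).prod (hPo.prod hPo)) hTc hdisj
  have hUs : ∀ p ∈ U, ∀ t : ℝ, 0 < t → t * φ p < u := by
    intro p hp t ht
    rw [← smul_eq_mul, ← map_smul]
    exact hφU _ ⟨⟨hPs _ hp.1.1 t ht, hPs _ hp.1.2 t ht⟩, hPs _ hp.2.1 t ht, hPs _ hp.2.2 t ht⟩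
  have h1U : ((Aff.one K, Aff.one K), (Aff.one K, Aff.one K)) ∈ U := ⟨⟨h1P, h1P⟩, h1P, h1P⟩
  have hu : 0 ≤ u := by
    by_contra hu
    push Not at hu
    have h1 := hUs _ h1U 1 one_pos
    rw [one_mul] at h1
    have h2 := hUs _ h1U (u / φ _) (div_pos_of_neg_of_neg hu (h1.trans hu))
    rw [div_mul_cancel₀ _ (h1.trans hu).ne] at h2
    exact lt_irrefl _ h2
  have hφneg : ∀ p ∈ U, φ p ≤ 0 := by
    intro p hp
    by_contra h
    push Not at h
    have h2 := hUs p hp ((u + 1) / φ p) (by positivity)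
    rw [div_mul_cancel₀ _ h.ne'] at h2
    linarith
  let ι₁ : Aff K →ₗ[ℝ] (Aff K × Aff K) × (Aff K × Aff K) :=
    LinearMap.inl ℝ _ _ ∘ₗ LinearMap.inl ℝ _ _
  let ι₂ : Aff K →ₗ[ℝ] (Aff K × Aff K) × (Aff K × Aff K) :=
    LinearMap.inl ℝ _ _ ∘ₗ LinearMap.inr ℝ _ _
  let ι₃ : Aff K →ₗ[ℝ] (Aff K × Aff K) × (Aff K × Aff K) :=
    LinearMap.inr ℝ _ _ ∘ₗ LinearMap.inl ℝ _ _
  let ι₄ : Aff K →ₗ[ℝ] (Aff K × Aff K) × (Aff K × Aff K) :=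
    LinearMap.inr ℝ _ _ ∘ₗ LinearMap.inr ℝ _ _
  have hsum : ∀ a b c d : Aff K, ((a, b), (c, d)) = ι₁ a + ι₂ b + ι₃ c + ι₄ d := by
    intro a b c d
    simp [ι₁, ι₂, ι₃, ι₄]
  -- A vector with one strictly positive component and three zeros only borders `U`; adding `δ`
  -- times the constant and letting `δ → 0` shows that each component of `-φ` is positive, hence a
  -- multiple of an evaluation.
  have hlim : ∀ (j : Aff K →ₗ[ℝ] (Aff K × Aff K) × (Aff K × Aff K)),
      (∀ k ∈ P, ∀ δ : ℝ, 0 < δ →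
        j k + δ • ((Aff.one K, Aff.one K), (Aff.one K, Aff.one K)) ∈ U) →
      ∀ k ∈ P, 0 ≤ (-(φ.toLinearMap ∘ₗ j)) k := by
    intro j hj k hk
    have h1 : ∀ δ : ℝ, 0 < δ →
        φ (j k) ≤ δ * -φ ((Aff.one K, Aff.one K), (Aff.one K, Aff.one K)) := by
      intro δ hδ
      have := hφneg _ (hj k hk δ hδ)
      rw [map_add, map_smul, smul_eq_mul] at this
      linarith
    have h2 : φ (j k) ≤ 0 := by
      have hcont : Filter.Tendsto
          (fun δ : ℝ => δ * -φ ((Aff.one K, Aff.one K), (Aff.one K, Aff.one K)))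
          (nhdsWithin 0 (Set.Ioi 0)) (nhds 0) := by
        have : Continuous
            (fun δ : ℝ => δ * -φ ((Aff.one K, Aff.one K), (Aff.one K, Aff.one K))) := by fun_prop
        simpa using (this.tendsto 0).mono_left nhdsWithin_le_nhds
      exact ge_of_tendsto hcont (eventually_nhdsWithin_of_forall h1)
    simpa using h2
  have hPadd : ∀ k ∈ P, ∀ l ∈ P, k + l ∈ P := fun k hk l hl x => add_pos (hk x) (hl x)
  have hrep : ∀ (j : Aff K →ₗ[ℝ] (Aff K × Aff K) × (Aff K × Aff K)),
      (∀ k ∈ P, ∀ δ : ℝ, 0 < δ →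
        j k + δ • ((Aff.one K, Aff.one K), (Aff.one K, Aff.one K)) ∈ U) →
      ∃ t : ℝ, 0 ≤ t ∧ ∃ x : K, ∀ g : Aff K, φ (j g) = -(t * (g : C(K, ℝ)) x) := by
    intro j hj
    obtain ⟨t, ht, x, hx⟩ := Aff.exists_eq_mul_eval hK.convex (-(φ.toLinearMap ∘ₗ j)) (hlim j hj)
    refine ⟨t, ht, x, fun g => ?_⟩
    rw [← hx g]
    simp
  obtain ⟨t₁, ht₁, x₁, hx₁⟩ := hrep ι₁ fun k hk δ hδ => by
    have h1 := hPs _ h1P δ hδ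
    have h2 := hPadd _ hk _ h1
    simpa [ι₁, U] using And.intro h2 h1
  obtain ⟨t₂, ht₂, x₂, hx₂⟩ := hrep ι₂ fun k hk δ hδ => by
    have h1 := hPs _ h1P δ hδ
    have h2 := hPadd _ hk _ h1
    simpa [ι₂, U] using And.intro (And.intro h1 h2) h1
  obtain ⟨t₃, ht₃, x₃, hx₃⟩ := hrep ι₃ fun k hk δ hδ => by
    have h1 := hPs _ h1P δ hδ
    have h2 := hPadd _ hk _ h1
    simpa [ι₃, U] using And.intro h1 (And.intro h2 h1)
  obtain ⟨t₄, ht₄, x₄, hx₄⟩ := hrep ι₄ fun k hk δ hδ => by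
    have h1 := hPs _ h1P δ hδ
    have h2 := hPadd _ hk _ h1
    simpa [ι₄, U] using And.intro h1 h2
  have hφ : ∀ a b c d : Aff K, φ ((a, b), (c, d)) =
      -(t₁ * (a : C(K, ℝ)) x₁) - t₂ * (b : C(K, ℝ)) x₂ - t₃ * (c : C(K, ℝ)) x₃ -
        t₄ * (d : C(K, ℝ)) x₄ := by
    intro a b c d
    rw [hsum, map_add, map_add, map_add, hx₁, hx₂, hx₃, hx₄]
    ring
  -- `φ (T h) = D h + γ`. Since `D` is linear and bounded below, it vanishes.
  let γ : ℝ := t₁ * (f₁ : C(K, ℝ)) x₁ + t₂ * (f₂ : C(K, ℝ)) x₂ - t₃ * (g₁ : C(K, ℝ)) x₃ -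
    t₄ * (g₂ : C(K, ℝ)) x₄
  let D : Aff K → ℝ := fun h => t₃ * (h : C(K, ℝ)) x₃ + t₄ * (h : C(K, ℝ)) x₄ -
    t₁ * (h : C(K, ℝ)) x₁ - t₂ * (h : C(K, ℝ)) x₂
  have hD : ∀ h, u ≤ D h + γ := by
    intro h
    have h1 := hφT _ ⟨h, rfl⟩
    simp only [T] at h1
    rw [hφ] at h1
    refine h1.trans_eq ?_
    simp [D, γ]
    ring
  have hDs : ∀ (r : ℝ) h, D (r • h) = r * D h := by
    intro r h
    simp [D]
    ring
  have hD0 : ∀ h, D h = 0 := by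
    intro h
    by_contra hne
    have h1 := hD (((u - γ - 1) / D h) • h)
    rw [hDs, div_mul_cancel₀ _ hne] at h1
    linarith
  have hγ : u ≤ γ := by simpa [hD0] using hD 0
  -- Testing `D = 0` on linear functionals and on the constant 1 gives an equality in the cone, to
  -- which Riesz decomposition applies.
  have hsumeq : (t₁ • (x₁ : E), t₁) + (t₂ • (x₂ : E), t₂) =
      (t₃ • (x₃ : E), t₃) + (t₄ • (x₄ : E), t₄) := by
    refine Prod.ext ?_ ?_
    · by_contra hne
      obtain ⟨ℓ, hℓ⟩ := exists_clm_ne hne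
      apply hℓ
      have h1 := hD0 (Aff.restrict K ℓ)
      simp only [D, Aff.restrict_apply] at h1
      simp only [Prod.mk_add_mk, map_add, map_smul, smul_eq_mul]
      linarith
    · have h1 := hD0 (Aff.one K)
      simp only [D, Aff.one_apply] at h1
      simp only [Prod.mk_add_mk]
      linarith
  obtain ⟨_, ⟨s₁₁, hs₁₁, z₁₁, hz₁₁, rfl⟩, _, ⟨s₁₂, hs₁₂, z₁₂, hz₁₂, rfl⟩,
    _, ⟨s₂₁, hs₂₁, z₂₁, hz₂₁, rfl⟩, _, ⟨s₂₂, hs₂₂, z₂₂, hz₂₂, rfl⟩, e₁, e₂, e₃, e₄⟩ :=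
    hK.exists_riesz_decomposition ⟨t₁, ht₁, x₁, x₁.2, rfl⟩ ⟨t₂, ht₂, x₂, x₂.2, rfl⟩
      ⟨t₃, ht₃, x₃, x₃.2, rfl⟩ ⟨t₄, ht₄, x₄, x₄.2, rfl⟩ hsumeq
  lift z₁₁ to K using hz₁₁
  lift z₁₂ to K using hz₁₂
  lift z₂₁ to K using hz₂₁
  lift z₂₂ to K using hz₂₂
  have E₁ := Aff.mul_apply_eq_add f₁ hs₁₁ hs₁₂ e₁
  have E₂ := Aff.mul_apply_eq_add f₂ hs₂₁ hs₂₂ e₂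
  have E₃ := Aff.mul_apply_eq_add g₁ hs₁₁ hs₂₁ e₃
  have E₄ := Aff.mul_apply_eq_add g₂ hs₁₂ hs₂₂ e₄
  -- The refinement turns `-γ` into a sum of terms `s * (g - f)` with `s ≥ 0` and `g - f > 0`. As `γ
  -- ≥ 0`, all weights vanish, so `φ = 0` and `γ = 0`, against `φ < u ≤ γ` on `U`.
  have hγ' : s₁₁ * ((g₁ : C(K, ℝ)) z₁₁ - (f₁ : C(K, ℝ)) z₁₁) +
      s₁₂ * ((g₂ : C(K, ℝ)) z₁₂ - (f₁ : C(K, ℝ)) z₁₂) +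
      s₂₁ * ((g₁ : C(K, ℝ)) z₂₁ - (f₂ : C(K, ℝ)) z₂₁) +
      s₂₂ * ((g₂ : C(K, ℝ)) z₂₂ - (f₂ : C(K, ℝ)) z₂₂) ≤ 0 := by
    have : 0 ≤ γ := hu.trans hγ
    simp only [γ] at this
    rw [E₁, E₂, E₃, E₄] at this
    linarith
  have p₁₁ := sub_pos.2 (h₁₁ z₁₁)
  have p₁₂ := sub_pos.2 (h₁₂ z₁₂)
  have p₂₁ := sub_pos.2 (h₂₁ z₂₁)
  have p₂₂ := sub_pos.2 (h₂₂ z₂₂)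
  have q₁₁ := mul_nonneg hs₁₁ p₁₁.le
  have q₁₂ := mul_nonneg hs₁₂ p₁₂.le
  have q₂₁ := mul_nonneg hs₂₁ p₂₁.le
  have q₂₂ := mul_nonneg hs₂₂ p₂₂.le
  have r₁₁ : s₁₁ = 0 := (mul_eq_zero.1 (show s₁₁ * _ = 0 by linarith)).resolve_right p₁₁.ne'
  have r₁₂ : s₁₂ = 0 := (mul_eq_zero.1 (show s₁₂ * _ = 0 by linarith)).resolve_right p₁₂.ne'
  have r₂₁ : s₂₁ = 0 := (mul_eq_zero.1 (show s₂₁ * _ = 0 by linarith)).resolve_right p₂₁.ne'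
  have r₂₂ : s₂₂ = 0 := (mul_eq_zero.1 (show s₂₂ * _ = 0 by linarith)).resolve_right p₂₂.ne'
  have w₁ : t₁ = s₁₁ + s₁₂ := congrArg Prod.snd e₁
  have w₂ : t₂ = s₂₁ + s₂₂ := congrArg Prod.snd e₂
  have w₃ : t₃ = s₁₁ + s₂₁ := congrArg Prod.snd e₃
  have w₄ : t₄ = s₁₂ + s₂₂ := congrArg Prod.snd e₄
  have hlt := hφU _ h1U
  rw [hφ] at hlt
  simp only [γ] at hγ
  simp only [w₁, w₂, w₃, w₄, r₁₁, r₁₂, r₂₁, r₂₂, add_zero, zero_mul, neg_zero, sub_zero]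
    at hlt hγ
  linarith

/-- If finitely many functionals span all restrictions to `K`, every continuous functional agrees on
`vectorSpan ℝ K` with a combination of them. They therefore separate its points, and it is
finite-dimensional. -/
theorem not_finiteDimensional_aff (hKinf : ¬ FiniteDimensional ℝ (vectorSpan ℝ K)) :
    ¬ FiniteDimensional ℝ (Aff K) := by
  intro hfin
  apply hKinf
  let R : Submodule ℝ (Aff K) := LinearMap.range (Aff.restrict K)
  have : Module.Free ℝ R := Module.Free.of_divisionRing ℝ R
  let B := Module.finBasis ℝ R
  choose ℓ hℓ using fun i => (B i).2
  let Φ : vectorSpan ℝ K →ₗ[ℝ] (Fin (Module.finrank ℝ R) → ℝ) :=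
    LinearMap.pi fun i => (ℓ i).toLinearMap.comp (vectorSpan ℝ K).subtype
  refine Module.Finite.of_injective Φ ((injective_iff_map_eq_zero Φ).2 fun w hw => ?_)
  by_contra hne
  have hne' : (w : E) ≠ 0 := fun h => hne (Subtype.ext h)
  obtain ⟨f, hf⟩ := exists_clm_ne hne'
  apply hf
  rw [map_zero]
  let c := B.repr ⟨Aff.restrict K f, f, rfl⟩
  let N : E →L[ℝ] ℝ := f - ∑ i, c i • ℓ i
  have hN : Aff.restrict K N = 0 := by
    have h1 := congrArg R.subtype (B.sum_repr ⟨Aff.restrict K f, f, rfl⟩)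
    simp only [N, map_sub, map_sum, map_smul, hℓ]
    simp only [map_sum, map_smul, Submodule.subtype_apply] at h1
    exact sub_eq_zero.2 h1.symm
  have hNK : ∀ x ∈ K, N x = 0 := fun x hx => by
    rw [← Aff.restrict_apply (K := K) N ⟨x, hx⟩, hN]; rfl
  have hNw : N w = 0 := by
    have : vectorSpan ℝ K ≤ LinearMap.ker N.toLinearMap := by
      refine Submodule.span_le.2 ?_
      rintro _ ⟨x, hx, y, hy, rfl⟩
      simp [hNK x hx, hNK y hy]
    exact this w.2
  have h2 : ∀ i, ℓ i w = 0 := fun i => congrFun hw i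
  simpa [N, h2] using hNw

end AffineFunctions

/-! ### Strictly ordered dense subgroups -/

section StrictlyOrderedGroups

theorem exists_pos_le_of_continuous {X : Type*} [TopologicalSpace X] [CompactSpace X] [Nonempty X]
    {f : X → ℝ} (hf : Continuous f)
    (hpos : ∀ x, 0 < f x) : ∃ ε > 0, ∀ x, ε ≤ f x := by
  obtain ⟨x, -, hx⟩ := isCompact_univ.exists_isMinOn Set.univ_nonempty hf.continuousOn
  exact ⟨f x, hpos x, fun y => hx (Set.mem_univ y)⟩

variable {E : Type u} [AddCommGroup E] [Module ℝ E] [TopologicalSpace E] {K : Set E}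
  {G : AddSubgroup (Aff K)}

namespace StrictlyOrdered

theorem le_iff {f g : StrictlyOrdered G} : f ≤ g ↔ f = g ∨ ∀ x, f.eval x < g.eval x := Iff.rfl

/-- Evaluation at a point as a homomorphism. -/
def evalHom (G : AddSubgroup (Aff K)) (x : K) : StrictlyOrdered G →+ ℝ :=
  AddMonoidHom.mk' (fun g => g.eval x) fun _ _ => rfl

theorem evalHom_apply (x : K) (g : StrictlyOrdered G) : evalHom G x g = g.eval x := rfl

theorem eval_add (f g : StrictlyOrdered G) (x : K) : (f + g).eval x = f.eval x + g.eval x := rfl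

theorem eval_zero (x : K) : (0 : StrictlyOrdered G).eval x = 0 := rfl

theorem eval_nsmul (n : ℕ) (g : StrictlyOrdered G) (x : K) : (n • g).eval x = n * g.eval x := by
  rw [← evalHom_apply, map_nsmul, evalHom_apply, nsmul_eq_mul]

theorem eval_one (h1 : Aff.one K ∈ G) (x : K) : (one h1).eval x = 1 := rfl

theorem nonneg_iff {g : StrictlyOrdered G} : 0 ≤ g ↔ g = 0 ∨ ∀ x, 0 < g.eval x := by
  rw [le_iff, eq_comm]
  rfl

instance : IsOrderedAddMonoid (StrictlyOrdered G) where
  add_le_add_left f g h k := by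
    rcases h with rfl | h
    · exact le_rfl
    · refine Or.inr fun x => ?_
      rw [eval_add, eval_add]
      linarith [h x]

theorem continuous_eval (g : StrictlyOrdered G) : Continuous fun x => g.eval x :=
  ContinuousMap.continuous _

theorem abs_eval_le [CompactSpace K] (g : StrictlyOrdered G) (x : K) : |g.eval x| ≤ ‖g.1‖ :=
  Aff.abs_apply_le_norm g.1 x

theorem isOrderUnit_one [CompactSpace K] (h1 : Aff.one K ∈ G) : IsOrderUnit (one h1) := by
  refine ⟨Or.inr fun x => zero_lt_one, fun g => ?_⟩
  obtain ⟨n, hn⟩ := exists_nat_gt ‖g.1‖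
  refine ⟨n, Or.inr fun x => ?_⟩
  rw [eval_nsmul, eval_one, mul_one]
  exact ((le_abs_self _).trans (abs_eval_le g x)).trans_lt hn

theorem isSimpleOrderedGroup [CompactSpace K] [Nonempty K] (h1 : Aff.one K ∈ G) :
    IsSimpleOrderedGroup (StrictlyOrdered G) := by
  refine ⟨⟨one h1, 0, fun h => ?_⟩, fun I hI => or_iff_not_imp_left.2 fun hbot => ?_⟩
  · have h2 := congrArg (fun g => g.eval (Classical.arbitrary K)) h
    simp only [eval_one, eval_zero] at h2
    exact one_ne_zero h2
  · obtain ⟨⟨x, hx⟩, hx0⟩ := (AddSubgroup.ne_bot_iff_exists_ne_zero).1 hbot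
    have hx0' : x ≠ 0 := fun h => hx0 (Subtype.ext h)
    -- In the strict order a nonzero positive element is strictly positive on `K`, hence bounded
    -- below by compactness; its multiples bracket every `g`.
    obtain ⟨c, hcI, hc⟩ : ∃ c ∈ I, ∀ y, 0 < c.eval y := by
      obtain ⟨a, ha, b, hb, ha0, hb0, hab⟩ := hI.2 x hx
      rcases nonneg_iff.1 ha0 with rfl | ha0
      · rcases nonneg_iff.1 hb0 with rfl | hb0
        · exact absurd (by rw [hab, sub_zero]) hx0'
        · exact ⟨b, hb, hb0⟩
      · exact ⟨a, ha, ha0⟩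
    obtain ⟨ε, hε, hεc⟩ := exists_pos_le_of_continuous (continuous_eval c) hc
    refine (AddSubgroup.eq_top_iff' I).2 fun g => ?_
    obtain ⟨n, hn⟩ := exists_nat_gt (‖g.1‖ / ε)
    rw [div_lt_iff₀ hε] at hn
    have hb : ∀ y, |g.eval y| < n * c.eval y := fun y =>
      (abs_eval_le g y).trans_lt (hn.trans_le (by gcongr; exact hεc y))
    refine hI.1 (-(n • c)) (I.neg_mem (I.nsmul_mem hcI n)) (n • c) (I.nsmul_mem hcI n) g
      (Or.inr fun y => ?_) (Or.inr fun y => ?_)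
    · rw [← evalHom_apply y (-(n • c)), map_neg, evalHom_apply, eval_nsmul]
      exact (abs_lt.1 (hb y)).1
    · rw [eval_nsmul]
      exact (abs_lt.1 (hb y)).2

theorem exists_eval_close [CompactSpace K] (hG : Dense (G : Set (Aff K))) (h : Aff K) {ε : ℝ}
    (hε : 0 < ε) : ∃ g : StrictlyOrdered G, ∀ x, |g.eval x - (h : C(K, ℝ)) x| < ε := by
  obtain ⟨g, hg, hgh⟩ := Metric.mem_closure_iff.1 (hG h) ε hε
  refine ⟨⟨g, hg⟩, fun x => ?_⟩
  rw [dist_comm, dist_eq_norm] at hgh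
  exact (Aff.abs_apply_le_norm (g - h) x).trans_lt hgh

theorem mem_traceSpace_eval (h1 : Aff.one K ∈ G) (x : K) :
    (fun g : StrictlyOrdered G => g.eval x) ∈ traceSpace (one h1) := by
  refine ⟨fun _ _ => rfl, fun g hg => ?_, rfl⟩
  rcases nonneg_iff.1 hg with rfl | hg
  · exact le_rfl
  · exact (hg x).le

theorem exists_eq_eval_of_mem_traceSpace [CompactSpace K] (hK : Convex ℝ K)
    (h1 : Aff.one K ∈ G) {τ : StrictlyOrdered G → ℝ} (hτ : τ ∈ traceSpace (one h1)) :
    ∃ x : K, ∀ g : StrictlyOrdered G, τ g = g.eval x := by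
  let t := traceHom hτ
  exact Aff.exists_eq_eval hK G h1 t (fun g hg => hτ.2.1 g (Or.inr hg)) hτ.2.2

theorem norm_le_pseudoNorm_one [CompactSpace K] (hK : Convex ℝ K) (h1 : Aff.one K ∈ G)
    (g : StrictlyOrdered G) : ‖(g.1 : C(K, ℝ))‖ ≤ pseudoNorm (one h1) g := by
  refine (ContinuousMap.norm_le _ (Real.iSup_nonneg fun _ => abs_nonneg _)).2 fun x => ?_
  -- Boundedness is essential, since an unbounded real supremum is 0 by convention; it holds because
  -- all traces are evaluations.
  have hb : BddAbove (Set.range fun τ : traceSpace (one h1) =>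
      |(τ : StrictlyOrdered G → ℝ) g|) := by
    refine ⟨‖g.1‖, ?_⟩
    rintro _ ⟨τ, rfl⟩
    obtain ⟨y, hy⟩ := exists_eq_eval_of_mem_traceSpace hK h1 τ.2
    simp only [hy]
    exact abs_eval_le g y
  exact le_ciSup hb ⟨_, mem_traceSpace_eval h1 x⟩

variable [IsTopologicalAddGroup E] [ContinuousSMul ℝ E] [LocallyConvexSpace ℝ E] [T2Space E]

theorem isDimensionGroup [CompactSpace K] [Nonempty K] (hK : IsChoquetSimplex K)
    (h1 : Aff.one K ∈ G) (hG : Dense (G : Set (Aff K))) :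
    IsDimensionGroup (StrictlyOrdered G) where
  isOrderedAddMonoid := inferInstance
  directed f g := by
    obtain ⟨n, hn⟩ := (isOrderUnit_one h1).2 f
    obtain ⟨m, hm⟩ := (isOrderUnit_one h1).2 g
    have h0 := (isOrderUnit_one h1).1
    exact ⟨(n + m) • one h1, hn.trans (nsmul_le_nsmul_left h0 (Nat.le_add_right _ _)),
      hm.trans (nsmul_le_nsmul_left h0 (Nat.le_add_left _ _))⟩
  unperforated n g hn hg := by
    have hn' : (0 : ℝ) < n := by exact_mod_cast hn
    rcases nonneg_iff.1 hg with hg | hg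
    · refine (le_of_eq (ext fun x => ?_))
      have h2 := congrArg (fun f => f.eval x) hg
      simp only [eval_nsmul, eval_zero] at h2
      rw [(mul_eq_zero.1 h2).resolve_left hn'.ne', eval_zero]
    · refine Or.inr fun x => ?_
      have h2 := hg x
      rw [eval_nsmul] at h2
      exact pos_of_mul_pos_right h2 hn'.le
  interpolation f₁ f₂ g₁ g₂ h₁₁ h₁₂ h₂₁ h₂₂ := by
    -- If one of the four relations is an equality, that common element interpolates. Only the
    -- all-strict case needs the simplex.
    rcases h₁₁ with rfl | l₁₁
    · exact ⟨f₁, le_rfl, h₂₁, le_rfl, h₁₂⟩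
    rcases h₁₂ with rfl | l₁₂
    · exact ⟨f₁, le_rfl, h₂₂, Or.inr l₁₁, le_rfl⟩
    rcases h₂₁ with rfl | l₂₁
    · exact ⟨f₂, Or.inr l₁₁, le_rfl, le_rfl, h₂₂⟩
    rcases h₂₂ with rfl | l₂₂
    · exact ⟨f₂, Or.inr l₁₂, le_rfl, Or.inr l₂₁, le_rfl⟩
    obtain ⟨h, hh⟩ := hK.exists_strict_interpolation f₁.1 f₂.1 g₁.1 g₂.1 l₁₁ l₁₂ l₂₁ l₂₂
    have hc : Continuous fun x => (h : C(K, ℝ)) x := ContinuousMap.continuous _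
    obtain ⟨ε, hε, hεx⟩ := exists_pos_le_of_continuous
      (f := fun x => min (min ((h : C(K, ℝ)) x - f₁.eval x) ((h : C(K, ℝ)) x - f₂.eval x))
        (min (g₁.eval x - (h : C(K, ℝ)) x) (g₂.eval x - (h : C(K, ℝ)) x)))
      (((hc.sub (continuous_eval f₁)).min (hc.sub (continuous_eval f₂))).min
        (((continuous_eval g₁).sub hc).min ((continuous_eval g₂).sub hc)))
      (fun x => lt_min (lt_min (sub_pos.2 (hh x).1) (sub_pos.2 (hh x).2.1))
        (lt_min (sub_pos.2 (hh x).2.2.1) (sub_pos.2 (hh x).2.2.2)))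
    obtain ⟨z, hz⟩ := exists_eval_close hG h hε
    simp only [le_min_iff] at hεx
    refine ⟨z, Or.inr fun x => ?_, Or.inr fun x => ?_, Or.inr fun x => ?_, Or.inr fun x => ?_⟩ <;>
    · have h2 := abs_lt.1 (hz x)
      obtain ⟨⟨h3, h4⟩, h5, h6⟩ := hεx x
      linarith

theorem exists_homeomorph_traceSpace [CompactSpace K] (hK : Convex ℝ K)
    (h1 : Aff.one K ∈ G) (hG : Dense (G : Set (Aff K))) :
    ∃ e : K ≃ₜ traceSpace (one h1),
      ∀ (x : K) (g : StrictlyOrdered G), (e x : StrictlyOrdered G → ℝ) g = g.eval x := by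
  let f : K → traceSpace (one h1) := fun x => ⟨fun g => g.eval x, mem_traceSpace_eval h1 x⟩
  have hf : Continuous f := (continuous_pi fun g => continuous_eval g).subtype_mk _
  have hbij : Function.Bijective f := by
    constructor
    · intro x y hxy
      by_contra hne
      obtain ⟨ℓ, hℓ⟩ := exists_clm_ne fun h => hne (Subtype.ext h)
      obtain ⟨g, hg⟩ := exists_eval_close hG (Aff.restrict K ℓ)
        (half_pos (abs_pos.2 (sub_ne_zero.2 hℓ)))
      have h2 : g.eval x = g.eval y := congrFun (congrArg Subtype.val hxy) g
      have hx := hg x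
      have hy := hg y
      rw [Aff.restrict_apply] at hx hy
      have h3 := abs_sub_le (ℓ (x : E)) (g.eval x) (ℓ (y : E))
      rw [abs_sub_comm (ℓ (x : E)) (g.eval x), h2] at h3
      rw [h2] at hx
      linarith
    · rintro ⟨τ, hτ⟩
      obtain ⟨x, hx⟩ := exists_eq_eval_of_mem_traceSpace hK h1 hτ
      exact ⟨x, Subtype.ext (funext fun g => (hx g).symm)⟩
  exact ⟨Continuous.homeoOfEquivCompactToT2 (f := Equiv.ofBijective f hbij) hf, fun x g => rfl⟩

theorem isStronglyAntiFD [CompactSpace K] [Nonempty K] (hK : IsChoquetSimplex K)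
    (h1 : Aff.one K ∈ G) (hG : Dense (G : Set (Aff K))) {κ : Type*} {b : κ → Aff K}
    (hb : LinearIndependent ℝ b) (hGb : G = (Submodule.span ℤ (Set.range b)).toAddSubgroup) :
    IsStronglyAntiFD.{u, v} (one h1) := by
  refine ⟨isDimensionGroup hK h1 hG, isOrderUnit_one h1, fun H _ _ e hH he φ hφ => ?_⟩
  -- The target becomes the complete space `C(K, ℝ)`, where `b` stays independent.
  let incl : StrictlyOrdered G →+ C(K, ℝ) :=
    (Aff K).subtype.toAddMonoidHom.comp G.subtype
  have hb' : LinearIndependent ℝ fun i => (b i : C(K, ℝ)) :=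
    hb.map' (Aff K).subtype (Aff K).ker_subtype
  have hzero : incl.comp φ = 0 := by
    refine hH.hom_eq_zero he hb' _ (fun g => ?_) fun ε hε => ?_
    · have h2 : (φ g).1 ∈ Submodule.span ℤ (Set.range b) := hGb.le (φ g).2
      have h3 := Submodule.mem_map_of_mem (f := (Aff K).subtype.toAddMonoidHom.toIntLinearMap) h2
      rw [Submodule.map_span, ← Set.range_comp] at h3
      exact h3
    · obtain ⟨δ, hδ, h⟩ := hφ 0 ε hε
      refine ⟨δ, hδ, fun g hg => (norm_le_pseudoNorm_one hK.convex h1 (φ g)).trans_lt ?_⟩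
      simpa using h g (by simpa using hg)
  ext1 g
  exact Subtype.ext (Subtype.ext (DFunLike.congr_fun hzero g))

end StrictlyOrdered

end StrictlyOrderedGroups

theorem proposition3p3 {E : Type u} [AddCommGroup E] [Module ℝ E] [TopologicalSpace E]
    [IsTopologicalAddGroup E] [ContinuousSMul ℝ E] [LocallyConvexSpace ℝ E] [T2Space E]
    (K : Set E) (hK : IsChoquetSimplex K) (hKinf : ¬ FiniteDimensional ℝ (vectorSpan ℝ K)) :
    ∃ (G : AddSubgroup (Aff K)) (h1 : Aff.one K ∈ G),
      Dense (G : Set (Aff K)) ∧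
      Module.Free ℤ G ∧
      (∀ S : AddSubgroup (Aff K), S ≤ G → S.FG → DiscreteTopology S) ∧
      IsDimensionGroup (StrictlyOrdered G) ∧
      IsSimpleOrderedGroup (StrictlyOrdered G) ∧
      IsOrderUnit (StrictlyOrdered.one h1) ∧
      (∃ e : K ≃ₜ traceSpace (StrictlyOrdered.one h1),
        (∀ (x : K) (g : StrictlyOrdered G), (e x : StrictlyOrdered G → ℝ) g = g.eval x) ∧
        ∀ (x y z : K) (a b : ℝ), 0 ≤ a → 0 ≤ b → a + b = 1 →
          (z : E) = a • (x : E) + b • (y : E) →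
          (e z : StrictlyOrdered G → ℝ) =
            a • (e x : StrictlyOrdered G → ℝ) + b • (e y : StrictlyOrdered G → ℝ)) ∧
      IsStronglyAntiFD.{u, v} (StrictlyOrdered.one h1) := by
  have hcompact : CompactSpace K := isCompact_iff_compactSpace.1 hK.isCompact
  have hne : Nonempty K := by
    rw [Set.nonempty_coe_sort, Set.nonempty_iff_ne_empty]
    rintro rfl
    apply hKinf
    rw [vectorSpan_empty]
    infer_instance
  have hone : Aff.one K ≠ 0 := fun h => by
    have h2 := congrArg (fun f : Aff K => (f : C(K, ℝ)) (Classical.arbitrary K)) h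
    exact one_ne_zero (α := ℝ) h2
  obtain ⟨κ, b, hb, hb1, hdense⟩ :=
    exists_linearIndependent_dense_span_int (not_finiteDimensional_aff hKinf) hone
  have h1 : Aff.one K ∈ (Submodule.span ℤ (Set.range b)).toAddSubgroup :=
    Submodule.subset_span hb1
  obtain ⟨e, he⟩ := StrictlyOrdered.exists_homeomorph_traceSpace hK.convex h1 hdense
  refine ⟨(Submodule.span ℤ (Set.range b)).toAddSubgroup, h1, hdense, ?_,
    fun S hS hfg => discreteTopology_of_fg_of_le_span_int hb S hS hfg,
    StrictlyOrdered.isDimensionGroup hK h1 hdense, StrictlyOrdered.isSimpleOrderedGroup h1,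
    StrictlyOrdered.isOrderUnit_one h1, ⟨e, he, fun x y z s t hs ht hst hz => ?_⟩,
    StrictlyOrdered.isStronglyAntiFD hK h1 hdense hb rfl⟩
  · have hbZ : LinearIndependent ℤ b :=
      hb.restrict_scalars fun m n hmn => by simpa using hmn
    exact Module.Free.of_basis (Module.Basis.span hbZ)
  · ext g
    simp only [Pi.add_apply, Pi.smul_apply, smul_eq_mul, he]
    exact g.1.2 x y z s t hs ht hst hz
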